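/- **Setting.** Fix a kind of component models (for instance splines, ReLU networks or boosted tree ensembles): each component is given by a finite description $c$, has a set of rational inputs on which it is defined, and takes rational values. Assume that inference takes polynomial time, i.e. the value of a component at an input in its domain can be computed in time polynomial in the bit length of the description and of the input. A classification GAM with $n$ features over an enumerable discrete input domain consists of weights $\beta_0,\dots,\beta_n\in\mathbb Q$, components $f_1,\dots,f_n$ of this kind, and explicitly listed finite sets $\mathcal X_i\subset\mathbb Q$ on which $f_i$ is defined; for $\mathbf x\in\mathbb F=\mathcal X_1\times\dots\times\mathcal X_n$, $$f(\mathbf x)=\mathrm{step}\Big(\beta_0+\sum_{i=1}^n\beta_i f_i(\mathbf x_i)\Big),\qquad \mathrm{step}(t)=1\text{ if }t\ge 0,\ \mathrm{step}(t)=0\text{ otherwise.}$$ Let $D$ be the least common denominator of the rationals $\beta_0$ and $\beta_i f_i(v)$ ($1\le i\le n$, $v\in\mathcal X_i$), and let $$N(f)=|D\beta_0|+\sum_{i=1}^n\sum_{v\in\mathcal X_i}|D\beta_i f_i(v)|$$ be the numerical magnitude of these values, i.e. essentially their length when they are written in unary as integer multiples of the unit $1/D$. *Pseudo-polynomial time*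 means time polynomial in the bit length of the instance (all numbers written in binary) plus $N(f)$; in particular, it is polynomial time when the weights and component values are integers written in unary. **Proposition.** For every such kind of components, the following two queries are computable in pseudo-polynomial time, by one algorithm each for all $n$ and all instances. 1. *Count-Completions (CC).* Given $f$, $\mathbf x\in\mathbb F$ and $S\subseteq[n]$, compute $$c(S,f,\mathbf x)=\frac{\big|\{\mathbf z\in\prod_{i\notin S}\mathcal X_i : f(\mathbf x_S;\mathbf z_{\bar S})=f(\mathbf x)\}\big|}{\big|\prod_{i\notin S}\mathcal X_i\big|}.$$ 2. *SHAP for classification.* Given $f$, rational probability distributions $p(i,\cdot)$ on $\mathcal X_i$ (listed), $\mathbf x\in\mathbb F$ and $i\in[n]$, compute $$\phi_i(f,\mathbf x)=\sum_{S\subseteq[n]\setminus\{i\}}\frac{|S|!\,(n-|S|-1)!}{n!}\big(v(S\cup\{i\})-v(S)\big),\qquad v(S)=\mathbb E_{\mathbf z\sim\mathcal D_p}[f(\mathbf z)\mid\mathbf z_S=\mathbf x_S],$$ where $\mathcal D_p$ is the product distribution $\Pr(\mathbf z)=\prod_j p(j,\mathbf z_j)$; if the event $\mathbf z_S=\mathbf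 x_S$ is null, $v(S)$ is read as $\mathbb E_{\mathbf z\sim\mathcal D_p}[f(\mathbf x_S;\mathbf z_{\bar S})]$, with which it agrees otherwise. -/

import Mathlib

namespace GamExplain

/-! ### A programming language with bit cost -/

/-- The data of programs: finite binary trees whose leaves carry integers. -/
inductive Val where
  | num (z : ℤ) : Val
  | pair (a b : Val) : Val

/-- The bit length of a datum: integers are written in binary. -/
def Val.size : Val → ℕ
  | .num z => 1 + Nat.size z.natAbs
  | .pair a b => 1 + a.size + b.size

/-- Lists of data, as right-nested pairs ended by the leaf `0`. -/
def Val.ofList : List Val → Val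
  | [] => .num 0
  | a :: l => .pair a (Val.ofList l)

/-- A rational as its reduced fraction, both parts written in binary. -/
def Val.ofRat (q : ℚ) : Val := .pair (.num q.num) (.num q.den)

/-- The datum `v` is a fraction (not necessarily reduced) with value `q`. -/
def Val.Represents (v : Val) (q : ℚ) : Prop :=
  ∃ a b : ℤ, 0 < b ∧ v = .pair (.num a) (.num b) ∧ (a : ℚ) / (b : ℚ) = q

/-- The elementary operations. -/
inductive Op where
  | ident | fst | snd | isPair | add | sub | mul | div | le

/-- The result of an elementary operation; binary operations take a pair of integers, and
operations applied to a datum of the wrong shape return `0`. -/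
def Op.apply : Op → Val → Val
  | .ident, v => v
  | .fst, .pair a _ => a
  | .snd, .pair _ b => b
  | .isPair, .pair _ _ => .num 1
  | .add, .pair (.num a) (.num b) => .num (a + b)
  | .sub, .pair (.num a) (.num b) => .num (a - b)
  | .mul, .pair (.num a) (.num b) => .num (a * b)
  | .div, .pair (.num a) (.num b) => .num (a / b)
  | .le, .pair (.num a) (.num b) => if a ≤ b then .num 1 else .num 0
  | _, _ => .num 0

/-- The time of an elementary operation: linear in the bit length of its argument, and quadratic
for multiplication and division (the schoolbook methods). -/
def Op.cost : Op → Val → ℕ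
  | .mul, v => (1 + v.size) ^ 2
  | .div, v => (1 + v.size) ^ 2
  | _, v => 1 + v.size

/-- Programs. Each program transforms one datum. -/
inductive Prog where
  /-- an elementary operation -/
  | op (o : Op) : Prog
  /-- the constant `w` -/
  | const (w : Val) : Prog
  /-- first `f`, then `g` on the result of `f` -/
  | seq (f g : Prog) : Prog
  /-- the pair of the results of `f` and of `g` -/
  | both (f g : Prog) : Prog
  /-- `g` if the result of `c` is `0`, and `f` otherwise -/
  | ite (c f g : Prog) : Prog
  /-- repeat `f` as long as the result of `c` is not `0` -/
  | loop (c f : Prog) : Prog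

/-- `Run f v w t`: on input `v`, the program `f` halts with output `w` after time `t`.
Every step that reads, copies or returns a datum is charged the bit length of that datum. -/
inductive Run : Prog → Val → Val → ℕ → Prop where
  | op (o : Op) (v : Val) : Run (.op o) v (o.apply v) (o.cost v)
  | const (w v : Val) : Run (.const w) v w (1 + w.size)
  | seq {f g : Prog} {v w u : Val} {s t : ℕ} :
      Run f v w s → Run g w u t → Run (.seq f g) v u (s + t + 1)
  | both {f g : Prog} {v a b : Val} {s t : ℕ} :
      Run f v a s → Run g v b t → Run (.both f g) v (.pair a b) (s + t + 1 + v.size)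
  | iteTrue {c f g : Prog} {v b w : Val} {s t : ℕ} :
      Run c v b s → b ≠ .num 0 → Run f v w t → Run (.ite c f g) v w (s + t + 1 + v.size)
  | iteFalse {c f g : Prog} {v w : Val} {s t : ℕ} :
      Run c v (.num 0) s → Run g v w t → Run (.ite c f g) v w (s + t + 1 + v.size)
  | loopStop {c f : Prog} {v : Val} {s : ℕ} :
      Run c v (.num 0) s → Run (.loop c f) v v (s + 1 + v.size)
  | loopStep {c f : Prog} {v b w u : Val} {s t r : ℕ} :
      Run c v b s → b ≠ .num 0 → Run f v w t → Run (.loop c f) w u r →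
      Run (.loop c f) v u (s + t + r + 1 + v.size)

/-- Programs are deterministic: output and running time are determined by the input. -/
theorem Run.deterministic {f : Prog} {v w w' : Val} {t t' : ℕ}
    (h : Run f v w t) (h' : Run f v w' t') : w = w' ∧ t = t' := by
  induction h generalizing w' t' with
  | op o v => cases h'; exact ⟨rfl, rfl⟩
  | const w v => cases h'; exact ⟨rfl, rfl⟩
  | seq _ _ ih₁ ih₂ =>
    cases h' with
    | seq h₁ h₂ =>
      obtain ⟨rfl, rfl⟩ := ih₁ h₁
      obtain ⟨rfl, rfl⟩ := ih₂ h₂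
      exact ⟨rfl, rfl⟩
  | both _ _ ih₁ ih₂ =>
    cases h' with
    | both h₁ h₂ =>
      obtain ⟨rfl, rfl⟩ := ih₁ h₁
      obtain ⟨rfl, rfl⟩ := ih₂ h₂
      exact ⟨rfl, rfl⟩
  | iteTrue _ hb _ ih₁ ih₂ =>
    cases h' with
    | iteTrue h₁ _ h₂ =>
      obtain ⟨rfl, rfl⟩ := ih₁ h₁
      obtain ⟨rfl, rfl⟩ := ih₂ h₂
      exact ⟨rfl, rfl⟩
    | iteFalse h₁ _ => exact absurd (ih₁ h₁).1 hb
  | iteFalse _ _ ih₁ ih₂ =>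
    cases h' with
    | iteTrue h₁ hb _ => exact absurd (ih₁ h₁).1.symm hb
    | iteFalse h₁ h₂ =>
      obtain ⟨_, rfl⟩ := ih₁ h₁
      obtain ⟨rfl, rfl⟩ := ih₂ h₂
      exact ⟨rfl, rfl⟩
  | loopStop _ ih₁ =>
    cases h' with
    | loopStop h₁ =>
      obtain ⟨_, rfl⟩ := ih₁ h₁
      exact ⟨rfl, rfl⟩
    | loopStep h₁ hb _ _ => exact absurd (ih₁ h₁).1.symm hb
  | loopStep _ hb _ _ ih₁ ih₂ ih₃ =>
    cases h' with
    | loopStop h₁ => exact absurd (ih₁ h₁).1 hb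
    | loopStep h₁ _ h₂ h₃ =>
      obtain ⟨rfl, rfl⟩ := ih₁ h₁
      obtain ⟨rfl, rfl⟩ := ih₂ h₂
      obtain ⟨rfl, rfl⟩ := ih₃ h₃
      exact ⟨rfl, rfl⟩

/-- The rational-valued function `q` of instances is computed by one program whose running time is
bounded by a polynomial in the bit length of the encoded instance and the magnitude `mag` of the
numbers that occur in it. -/
def PseudoPolyTime {I : Type} (encode : I → Val) (mag : I → ℕ) (q : I → ℚ) : Prop :=
  ∃ (f : Prog) (P : Polynomial ℕ), ∀ a : I, ∃ (out : Val) (t : ℕ),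
    Run f (encode a) out t ∧ out.Represents (q a) ∧ t ≤ P.eval ((encode a).size + mag a)

/-! ### Generalized additive models -/

/-- A kind of component models (splines, neural networks, tree ensembles, ...): each component is
given by a finite description, is defined on a set of rational inputs, and has rational values. -/
structure ComponentKind where
  /-- the inputs on which the component described by `c` is defined
  (none, if `c` describes no component) -/
  domain : Val → Set ℚ
  /-- the value of the component described by `c` at an input -/
  value : Val → ℚ → ℚ

/-- Inference takes polynomial time: one program evaluates every component of the kind in time
polynomial in the bit length of the description and of the input. -/
def ComponentKind.PolyTimeInference (C : ComponentKind) : Prop :=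
  ∃ (f : Prog) (P : Polynomial ℕ), ∀ (c : Val) (v : ℚ), v ∈ C.domain c →
    ∃ (out : Val) (t : ℕ), Run f (.pair c (.ofRat v)) out t ∧ out.Represents (C.value c v) ∧
      t ≤ P.eval (Val.pair c (.ofRat v)).size

/-- A generalized additive model with `n` features over an enumerable discrete input domain. -/
structure GAM (C : ComponentKind) (n : ℕ) where
  /-- the intercept -/
  β₀ : ℚ
  /-- the weights of the components -/
  β : Fin n → ℚ
  /-- the descriptions of the components -/
  comp : Fin n → Val
  /-- the domain of each feature, listed -/
  X : Fin n → List ℚ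
  nodup : ∀ i, (X i).Nodup
  defined : ∀ i, ∀ v ∈ X i, v ∈ C.domain (comp i)

namespace GAM

variable {C : ComponentKind} {n : ℕ} (g : GAM C n)

/-- The `i`-th component function. -/
def f (i : Fin n) (v : ℚ) : ℚ := C.value (g.comp i) v

/-- The additive prediction, before the step function. -/
def score (x : Fin n → ℚ) : ℚ := g.β₀ + ∑ i, g.β i * g.f i (x i)

/-- The classification of `x`: the step function of the additive prediction. -/
def classify (x : Fin n → ℚ) : ℚ := if 0 ≤ g.score x then 1 else 0

/-- The input space. -/
def inputs : Finset (Fin n → ℚ) := Fintype.piFinset fun i => (g.X i).toFinset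

/-- The least common denominator of `β₀` and of all the weighted component values
`βᵢ fᵢ(v)`, `v ∈ Xᵢ`. -/
def commonDen : ℕ :=
  Nat.lcm g.β₀.den (Finset.univ.lcm fun i => (g.X i).toFinset.lcm fun v => (g.β i * g.f i v).den)

/-- The sum of the absolute values of `β₀` and of all the weighted component values
`βᵢ fᵢ(v)`, `v ∈ Xᵢ`, as integer multiples of the unit `1 / commonDen`: up to a constant
factor and the number of these values, the length of the weights of the model in unary. -/
def magnitude : ℕ :=
  (g.commonDen * g.β₀).num.natAbs +
    ∑ i, ∑ v ∈ (g.X i).toFinset, (g.commonDen * (g.β i * g.f i v)).num.natAbs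

/-- The description of a model. All numbers are written in binary. -/
def encode : Val :=
  .pair (.ofRat g.β₀) (.ofList (List.ofFn fun i =>
    .pair (.ofRat (g.β i)) (.pair (g.comp i) (.ofList ((g.X i).map .ofRat)))))

/-! ### Count completions -/

/-- The assignments to the features outside `S`. -/
def completions (S : Finset (Fin n)) : Finset ({i // i ∉ S} → ℚ) :=
  Fintype.piFinset fun i => (g.X i).toFinset

/-- The input with the values of `x` on `S` and those of `z` outside `S`. -/
def combine (S : Finset (Fin n)) (x : Fin n → ℚ) (z : {i // i ∉ S} → ℚ) : Fin n → ℚ :=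
  fun i => if h : i ∈ S then x i else z ⟨i, h⟩

/-- The completion count: the proportion of the completions of `x` on `S` that keep the
classification of `x`. -/
def completionCount (x : Fin n → ℚ) (S : Finset (Fin n)) : ℚ :=
  (((g.completions S).filter fun z => g.classify (combine S x z) = g.classify x).card : ℚ) /
    ((g.completions S).card : ℚ)

/-! ### Shapley values -/

/-- `p` describes a fully factorized distribution: `p i` is a distribution on the domain of
feature `i`. -/
def IsProductDistribution (p : Fin n → ℚ → ℚ) : Prop :=
  ∀ i, (∀ v ∈ g.X i, 0 ≤ p i v) ∧ ∑ v ∈ (g.X i).toFinset, p i v = 1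

/-- The probability of the input `z`, with independent features. -/
def prob (p : Fin n → ℚ → ℚ) (z : Fin n → ℚ) : ℚ := ∏ i, p i (z i)

/-- The inputs that agree with `x` on `S`. -/
def agreeing (x : Fin n → ℚ) (S : Finset (Fin n)) : Finset (Fin n → ℚ) :=
  g.inputs.filter fun z => ∀ i ∈ S, z i = x i

/-- The value function: the conditional expectation of the classification of a random input that
agrees with `x` on `S`. If this event is null, the conditional distribution is the one that
independence of the features gives: the features in `S` are fixed and the others keep their
distributions. -/
def valueFunction (p : Fin n → ℚ → ℚ) (x : Fin n → ℚ) (S : Finset (Fin n)) : ℚ :=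
  if ∑ z ∈ g.agreeing x S, prob p z = 0 then
    ∑ z ∈ g.inputs, prob p z * g.classify (S.piecewise x z)
  else
    (∑ z ∈ g.agreeing x S, prob p z * g.classify z) / ∑ z ∈ g.agreeing x S, prob p z

/-- The Shapley value of feature `i` for the classification of `x`. -/
def shap (p : Fin n → ℚ → ℚ) (x : Fin n → ℚ) (i : Fin n) : ℚ :=
  ∑ S ∈ (Finset.univ.erase i).powerset,
    ((S.card.factorial * (n - S.card - 1).factorial : ℕ) : ℚ) / (n.factorial : ℚ) *
      (g.valueFunction p x (insert i S) - g.valueFunction p x S)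

end GAM

/-- An instance of the Count-Completions query: a model, an input and a set of features. -/
structure CCInstance (C : ComponentKind) where
  n : ℕ
  g : GAM C n
  x : Fin n → ℚ
  hx : ∀ i, x i ∈ g.X i
  S : Finset (Fin n)

/-- The model, the list of the values of `x`, and the list of the indicator bits of `S`. -/
def CCInstance.encode {C : ComponentKind} (a : CCInstance C) : Val :=
  .pair a.g.encode (.pair (.ofList (List.ofFn fun i => .ofRat (a.x i)))
    (.ofList (List.ofFn fun i => if i ∈ a.S then .num 1 else .num 0)))

/-- An instance of the SHAP query: a model, a fully factorized distribution, an input and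
a feature. -/
structure ShapInstance (C : ComponentKind) where
  n : ℕ
  g : GAM C n
  p : Fin n → ℚ → ℚ
  hp : g.IsProductDistribution p
  x : Fin n → ℚ
  hx : ∀ i, x i ∈ g.X i
  i : Fin n

/-- The model, the table of the probabilities (in the order of the listed domains), the list of
the values of `x`, and the index of the feature. -/
def ShapInstance.encode {C : ComponentKind} (a : ShapInstance C) : Val :=
  .pair a.g.encode (.pair
    (.ofList (List.ofFn fun j => .ofList ((a.g.X j).map fun v => .ofRat (a.p j v))))
    (.pair (.ofList (List.ofFn fun j => .ofRat (a.x j))) (.num (a.i : ℕ))))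

end GamExplain

/-!
The algorithm is the dynamic program over the values of the score, the one that solves counting
knapsack. The weighted component values are multiplied by a common denominator `D`, so that the
score of an input becomes a sum of integer keys. A feature is turned into a list of terms
(key, weight), one for each of its possible values, which stands for an element of the monoid
algebra `ℚ[ℤ × ℤ]`; the product of these elements is the distribution of the score when the
features vary independently (`sum_piFinset_eq_functional`), and both queries are linear functionals
of such a product. For the completion count, the features in `S` have one term and the functional
adds up the weights of the nonnegative keys (`completionCount_eq`). For the Shapley value, a feature
`j ≠ i` has one term for being fixed and one for each random value, and a second exponent counts the
fixed features; the terms of `i` are those of being fixed minus those of being random. Expanding the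
product gives the sum over all coalitions `S` of the differences of the value function, sorted by
the size of `S`, on which the Shapley weight depends (`toAlg_prod_shapTerms`, `shap_eq`).

The running time is governed by the number of different exponents, since terms with equal exponents
are merged after each multiplication. All keys are multiples of `u = D / commonDen`, and the sum
of their absolute values is at most `u` times the magnitude (`exists_unit`); hence there are polynomially many exponents
(`length_prodTerms_le`). For this, `D` need not be the least common denominator: the product of all
denominators will do, and no greatest common divisors are computed.

Programs are never written down. The predicate `PolyTime sz e g` says that some program computes
`g a` from `e a` in time polynomial in `sz a`, uniformly in `a`; it is closed under the usual list
operations, by way of `PolyTime.foldl`, which asks that the states of a loop keep polynomial size.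
-/

namespace GamExplain

/-! ### Sizes and polynomial bounds -/

theorem Val.one_le_size (v : Val) : 1 ≤ v.size := by
  cases v <;> simp only [Val.size] <;> omega

theorem size_add_le (a b : ℕ) : Nat.size (a + b) ≤ Nat.size a + Nat.size b := by
  rcases Nat.eq_zero_or_pos a with rfl | ha
  · simp
  rcases Nat.eq_zero_or_pos b with rfl | hb
  · simp
  rw [Nat.size_le, pow_add]
  have h₁ : a + 1 ≤ 2 ^ Nat.size a := Nat.lt_size_self a
  have h₂ : b + 1 ≤ 2 ^ Nat.size b := Nat.lt_size_self b
  nlinarith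

theorem size_mul_le (a b : ℕ) : Nat.size (a * b) ≤ Nat.size a + Nat.size b := by
  rw [Nat.size_le, pow_add]
  exact Nat.mul_lt_mul'' (Nat.lt_size_self a) (Nat.lt_size_self b)

theorem Val.size_num_add_le (a b : ℤ) :
    Nat.size (a + b).natAbs ≤ Nat.size a.natAbs + Nat.size b.natAbs :=
  (Nat.size_le_size (Int.natAbs_add_le a b)).trans (size_add_le _ _)

theorem Val.size_num_mul_le (a b : ℤ) :
    Nat.size (a * b).natAbs ≤ Nat.size a.natAbs + Nat.size b.natAbs := by
  rw [Int.natAbs_mul]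
  exact size_mul_le _ _

theorem Op.size_apply_le (o : Op) (v : Val) : (o.apply v).size ≤ 1 + v.size := by
  have h0 : (Val.num 0).size = 1 := by simp [Val.size]
  have h1 : (Val.num 1).size = 2 := by simp [Val.size]
  have hv := v.one_le_size
  rcases o with _ | _ | _ | _ | _ | _ | _ | _ | _ <;> rcases v with z | ⟨a | ⟨a, a'⟩, b | ⟨b, b'⟩⟩ <;>
    simp only [Op.apply, Val.size, h0, h1] at hv ⊢ <;> try omega
  · have := Val.size_num_add_le a b
    omega
  · have := Val.size_num_add_le a (-b)
    rw [Int.natAbs_neg, ← sub_eq_add_neg] at this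
    omega
  · have := Val.size_num_mul_le a b
    omega
  · have := Nat.size_le_size (Int.natAbs_ediv_le_natAbs a b)
    omega
  · split_ifs <;> simp only [h0, h1] <;> omega

theorem Op.le_cost (o : Op) (v : Val) : 1 + v.size ≤ o.cost v := by
  cases o <;> simp only [Op.cost, le_refl] <;> nlinarith

/-- Returning a datum is charged its bit length, so the running time bounds the size of the
output. -/
theorem Run.size_le {f : Prog} {v w : Val} {t : ℕ} (h : Run f v w t) : w.size ≤ t := by
  induction h with
  | op o v => exact (o.size_apply_le v).trans (o.le_cost v)
  | const => omega
  | seq => omega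
  | both => simp only [Val.size]; omega
  | iteTrue => omega
  | iteFalse => omega
  | loopStop => omega
  | loopStep => omega

/-- The quantity `s` is bounded by a polynomial in the quantity `sz`, over a family of instances
indexed by `I`. -/
def PolyBounded {I : Type} (sz s : I → ℕ) : Prop :=
  ∃ P : Polynomial ℕ, ∀ a, s a ≤ P.eval (sz a)

theorem eval_mono (P : Polynomial ℕ) {a b : ℕ} (h : a ≤ b) : P.eval a ≤ P.eval b := by
  simp only [Polynomial.eval_eq_sum_range]
  gcongr

namespace PolyBounded

variable {I J : Type} {sz s s' : I → ℕ}

theorem self : PolyBounded sz sz := ⟨Polynomial.X, fun a => by simp⟩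

theorem const (c : ℕ) : PolyBounded sz (fun _ => c) := ⟨Polynomial.C c, fun a => by simp⟩

theorem mono (h : PolyBounded sz s) (h' : ∀ a, s' a ≤ s a) : PolyBounded sz s' :=
  h.imp fun _ hP a => (h' a).trans (hP a)

theorem add (h : PolyBounded sz s) (h' : PolyBounded sz s') :
    PolyBounded sz (fun a => s a + s' a) := by
  obtain ⟨P, hP⟩ := h
  obtain ⟨Q, hQ⟩ := h'
  exact ⟨P + Q, fun a => by simpa using Nat.add_le_add (hP a) (hQ a)⟩

theorem mul (h : PolyBounded sz s) (h' : PolyBounded sz s') :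
    PolyBounded sz (fun a => s a * s' a) := by
  obtain ⟨P, hP⟩ := h
  obtain ⟨Q, hQ⟩ := h'
  exact ⟨P * Q, fun a => by simpa using Nat.mul_le_mul (hP a) (hQ a)⟩

theorem pow (h : PolyBounded sz s) (k : ℕ) : PolyBounded sz (fun a => s a ^ k) := by
  obtain ⟨P, hP⟩ := h
  exact ⟨P ^ k, fun a => by simpa using Nat.pow_le_pow_left (hP a) k⟩

theorem comap (h : PolyBounded sz s) (φ : J → I) :
    PolyBounded (fun j => sz (φ j)) (fun j => s (φ j)) :=
  h.imp fun _ hP j => hP (φ j)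

theorem trans (h : PolyBounded sz s) (h' : PolyBounded s s') : PolyBounded sz s' := by
  obtain ⟨P, hP⟩ := h
  obtain ⟨Q, hQ⟩ := h'
  exact ⟨Q.comp P, fun _ => by
    simpa [Polynomial.eval_comp] using (hQ _).trans (eval_mono Q (hP _))⟩

end PolyBounded

/-! ### Polynomial-time computable functions of instances -/

/-- Types whose elements are represented by data of the programming language. -/
class Datum (α : Type) where
  /-- the datum that represents an element -/
  enc : α → Val

open Datum (enc)

instance : Datum Val := ⟨id⟩
instance : Datum ℤ := ⟨.num⟩
instance : Datum ℚ := ⟨.ofRat⟩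
instance {α β : Type} [Datum α] [Datum β] : Datum (α × β) := ⟨fun p => .pair (enc p.1) (enc p.2)⟩
instance {α : Type} [Datum α] : Datum (List α) := ⟨fun l => .ofList (l.map enc)⟩

/-- From the datum `e a`, one program computes `g a` in time polynomial in `sz a`, for all
instances `a : I`. The index type is arbitrary, so that the body of a loop is judged over the type
of all the states that the loop reaches, with the parameter `sz` of the surrounding instance. The
datum `e a` has to have polynomial size itself, since programs pay for copying their input. -/
def PolyTime {I γ α : Type} [Datum γ] [Datum α] (sz : I → ℕ) (e : I → γ) (g : I → α) : Prop :=
  ∃ (f : Prog) (t : I → ℕ), PolyBounded sz t ∧ PolyBounded sz (fun a => (enc (e a)).size) ∧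
    ∀ a, Run f (enc (e a)) (enc (g a)) (t a)

namespace PolyTime

variable {I J γ δ α β σ : Type} [Datum γ] [Datum δ] [Datum α] [Datum β] [Datum σ]
  {sz : I → ℕ} {e : I → γ}

theorem source {g : I → α} (h : PolyTime sz e g) : PolyBounded sz fun a => (enc (e a)).size := by
  obtain ⟨_, _, _, h, _⟩ := h
  exact h

theorem bounded {g : I → α} (h : PolyTime sz e g) : PolyBounded sz fun a => (enc (g a)).size := by
  obtain ⟨_, _, ht, _, h⟩ := h
  exact ht.mono fun a => (h a).size_le

/-- Only the data matter, not the types of the objects that they represent. -/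
theorem congr {g : I → α} {g' : I → β} (h : PolyTime sz e g) (h' : ∀ a, enc (g a) = enc (g' a)) :
    PolyTime sz e g' := by
  obtain ⟨f, t, ht, he, h⟩ := h
  exact ⟨f, t, ht, he, fun a => h' a ▸ h a⟩

theorem op {g : I → α} (h : PolyTime sz e g) (o : Op) {g' : I → β}
    (h' : ∀ a, o.apply (enc (g a)) = enc (g' a)) : PolyTime sz e g' := by
  obtain ⟨f, t, ht, he, hf⟩ := id h
  refine ⟨.seq f (.op o), fun a => t a + o.cost (enc (g a)) + 1, ?_, he, fun a => ?_⟩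
  · refine ((ht.add (((PolyBounded.const 1).add h.bounded).pow 2)).add (.const 1)).mono fun a => ?_
    have : o.cost (enc (g a)) ≤ (1 + (enc (g a)).size) ^ 2 := by
      cases o <;> simp only [Op.cost, le_refl] <;> nlinarith
    omega
  · rw [← h' a]
    exact .seq (hf a) (.op o _)

theorem refl (h : PolyBounded sz fun a => (enc (e a)).size) : PolyTime sz e e :=
  ⟨.op .ident, fun a => 1 + (enc (e a)).size, (PolyBounded.const 1).add h, h,
    fun _ => .op .ident _⟩

theorem trans {g : I → α} {g' : I → β} (h : PolyTime sz e g) (h' : PolyTime sz g g') :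
    PolyTime sz e g' := by
  obtain ⟨f, t, ht, he, h⟩ := h
  obtain ⟨f', t', ht', _, h'⟩ := h'
  exact ⟨.seq f f', fun a => t a + t' a + 1, (ht.add ht').add (.const 1), he,
    fun a => .seq (h a) (h' a)⟩

/-- Restriction or extension of the family of instances. -/
theorem comap {g : I → α} (h : PolyTime sz e g) (φ : J → I) :
    PolyTime (fun j => sz (φ j)) (fun j => e (φ j)) (fun j => g (φ j)) := by
  obtain ⟨f, t, ht, he, h⟩ := h
  exact ⟨f, fun j => t (φ j), ht.comap φ, he.comap φ, fun j => h (φ j)⟩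

/-- What is computable from `e` is computable wherever `e` is. -/
theorem weaken {g : I → α} (h : PolyTime sz e g) {φ : J → I} {e' : J → δ}
    (h' : PolyTime (fun j => sz (φ j)) e' (fun j => e (φ j))) :
    PolyTime (fun j => sz (φ j)) e' (fun j => g (φ j)) :=
  h'.trans (h.comap φ)

theorem const {g : I → α} (h : PolyTime sz e g) (b : β) : PolyTime sz e fun _ => b :=
  ⟨.const (enc b), fun _ => 1 + (enc b).size, .const _, h.source, fun _ => .const _ _⟩

theorem pair {g : I → α} {g' : I → β} (h : PolyTime sz e g) (h' : PolyTime sz e g') :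
    PolyTime sz e fun a => (g a, g' a) := by
  obtain ⟨f, t, ht, he, h⟩ := h
  obtain ⟨f', t', ht', _, h'⟩ := h'
  exact ⟨.both f f', fun a => t a + t' a + 1 + (enc (e a)).size,
    ((ht.add ht').add (.const 1)).add he, he, fun a => .both (h a) (h' a)⟩

theorem fst {g : I → α × β} (h : PolyTime sz e g) : PolyTime sz e fun a => (g a).1 :=
  h.op .fst fun _ => rfl

theorem snd {g : I → α × β} (h : PolyTime sz e g) : PolyTime sz e fun a => (g a).2 :=
  h.op .snd fun _ => rfl

theorem num {q : I → ℚ} (h : PolyTime sz e q) : PolyTime sz e fun a => (q a).num :=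
  h.op .fst fun _ => rfl

theorem den {q : I → ℚ} (h : PolyTime sz e q) : PolyTime sz e fun a => ((q a).den : ℤ) :=
  h.op .snd fun _ => rfl

theorem add {x y : I → ℤ} (hx : PolyTime sz e x) (hy : PolyTime sz e y) :
    PolyTime sz e fun a => x a + y a := (hx.pair hy).op .add fun _ => rfl
theorem sub {x y : I → ℤ} (hx : PolyTime sz e x) (hy : PolyTime sz e y) :
    PolyTime sz e fun a => x a - y a := (hx.pair hy).op .sub fun _ => rfl
theorem mul {x y : I → ℤ} (hx : PolyTime sz e x) (hy : PolyTime sz e y) :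
    PolyTime sz e fun a => x a * y a := (hx.pair hy).op .mul fun _ => rfl
theorem div {x y : I → ℤ} (hx : PolyTime sz e x) (hy : PolyTime sz e y) :
    PolyTime sz e fun a => x a / y a := (hx.pair hy).op .div fun _ => rfl

theorem le {x y : I → ℤ} (hx : PolyTime sz e x) (hy : PolyTime sz e y) :
    PolyTime sz e fun a => if x a ≤ y a then (1 : ℤ) else 0 :=
  (hx.pair hy).op .le fun a => by
    change (if x a ≤ y a then Val.num 1 else Val.num 0) = _
    split_ifs <;> rfl

/-- Branching on whether an integer is zero. -/
theorem ifZero {x : I → ℤ} {g g' : I → α} (hx : PolyTime sz e x) (h : PolyTime sz e g)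
    (h' : PolyTime sz e g') : PolyTime sz e fun a => if x a = 0 then g a else g' a := by
  obtain ⟨c, s, hs, he, hc⟩ := hx
  obtain ⟨f, t, ht, _, h⟩ := h
  obtain ⟨f', t', ht', _, h'⟩ := h'
  refine ⟨.ite c f' f, fun a => s a + (if x a = 0 then t a else t' a) + 1 + (enc (e a)).size,
    (((hs.add (ht.add ht')).add (.const 1)).add he).mono fun a => ?_, he, fun a => ?_⟩
  · split_ifs <;> omega
  · beta_reduce
    split_ifs with hx
    · refine .iteFalse ?_ (h a)
      have := hc a
      rwa [hx] at this
    · refine .iteTrue (hc a) (fun h0 => hx ?_) (h' a)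
      exact Val.num.inj h0

theorem ite {c : I → Prop} [DecidablePred c] {g g' : I → α}
    (hc : PolyTime sz e fun a => if c a then (1 : ℤ) else 0) (h : PolyTime sz e g)
    (h' : PolyTime sz e g') : PolyTime sz e fun a => if c a then g a else g' a :=
  (hc.ifZero h' h).congr fun a => by by_cases hc : c a <;> simp [hc]

theorem eq {x y : I → ℤ} (hx : PolyTime sz e x) (hy : PolyTime sz e y) :
    PolyTime sz e fun a => if x a = y a then (1 : ℤ) else 0 :=
  ((hx.sub hy).ifZero (hx.const (1 : ℤ)) (hx.const (0 : ℤ))).congr fun a => by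
    simp only [sub_eq_zero]

theorem not {c : I → Prop} [DecidablePred c]
    (hc : PolyTime sz e fun a => if c a then (1 : ℤ) else 0) :
    PolyTime sz e fun a => if ¬ c a then (1 : ℤ) else 0 :=
  ((hc.const (1 : ℤ)).sub hc).congr fun a => by by_cases hc : c a <;> simp [hc]

theorem and {c d : I → Prop} [DecidablePred c] [DecidablePred d]
    (hc : PolyTime sz e fun a => if c a then (1 : ℤ) else 0)
    (hd : PolyTime sz e fun a => if d a then (1 : ℤ) else 0) :
    PolyTime sz e fun a => if c a ∧ d a then (1 : ℤ) else 0 :=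
  (hc.mul hd).congr fun a => by by_cases hc : c a <;> by_cases hd : d a <;> simp [hc, hd]

theorem nil {g : I → α} (h : PolyTime sz e g) : PolyTime sz e fun _ => ([] : List β) := h.const _

theorem cons {x : I → α} {l : I → List α} (hx : PolyTime sz e x) (hl : PolyTime sz e l) :
    PolyTime sz e fun a => x a :: l a :=
  (hx.pair hl).congr fun _ => rfl

theorem tail {l : I → List α} (hl : PolyTime sz e l) : PolyTime sz e fun a => (l a).tail :=
  hl.op .snd fun a => by
    rcases l a with _ | ⟨_, _⟩ <;> rfl

theorem headD {l : I → List Val} (hl : PolyTime sz e l) :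
    PolyTime sz e fun a => (l a).headD (.num 0) :=
  hl.op .fst fun a => by
    rcases l a with _ | ⟨_, _⟩ <;> rfl

end PolyTime

/-! ### Loops over lists -/

section lists

variable {α β γ σ : Type} [Datum α] [Datum β] [Datum γ] [Datum σ]

theorem size_enc_pair (x : α) (y : β) : (enc (x, y)).size = 1 + (enc x).size + (enc y).size := rfl

theorem size_enc_num (z : ℤ) : (enc z).size = 1 + Nat.size z.natAbs := rfl

theorem size_enc_nil : (enc ([] : List α)).size = 1 := by
  change (Val.num 0).size = 1
  simp [Val.size]

theorem size_enc_cons (x : α) (l : List α) :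
    (enc (x :: l)).size = 1 + (enc x).size + (enc l).size := rfl

theorem length_le_size (l : List α) : l.length ≤ (enc l).size := by
  induction l with
  | nil => simp
  | cons x l ih => rw [size_enc_cons, List.length_cons]; omega

theorem size_enc_append (l l' : List α) :
    (enc (l ++ l')).size + 1 = (enc l).size + (enc l').size := by
  induction l with
  | nil => rw [List.nil_append, size_enc_nil]; omega
  | cons x l ih => rw [List.cons_append, size_enc_cons, size_enc_cons]; omega

theorem size_enc_le_of_mem {x : α} {l : List α} (h : x ∈ l) : (enc x).size ≤ (enc l).size := by
  induction l with
  | nil => simp at h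
  | cons y l ih =>
    rw [size_enc_cons]
    rcases List.mem_cons.1 h with rfl | h
    · omega
    · have := ih h
      omega

theorem size_enc_le_of_sublist {l l' : List α} (h : l.Sublist l') :
    (enc l).size ≤ (enc l').size := by
  induction h with
  | slnil => exact le_rfl
  | cons x _ ih => rw [size_enc_cons]; omega
  | cons_cons x _ ih => rw [size_enc_cons, size_enc_cons]; omega

theorem size_enc_le_of_forall {B : ℕ} (l : List α) (h : ∀ x ∈ l, (enc x).size ≤ B) :
    (enc l).size ≤ 1 + l.length * (1 + B) := by
  induction l with
  | nil => simp [size_enc_nil]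
  | cons x l ih =>
    have h₁ := h x (by simp)
    have h₂ := ih fun y hy => h y (by simp [hy])
    rw [size_enc_cons, List.length_cons, Nat.add_mul, one_mul]
    omega

theorem size_enc_reverse (l : List α) : (enc l.reverse).size = (enc l).size := by
  induction l with
  | nil => rfl
  | cons x l ih =>
    have := size_enc_append l.reverse [x]
    rw [size_enc_cons, size_enc_nil] at this
    rw [List.reverse_cons, size_enc_cons]
    omega

/-- The loop of a fold, on a datum made of the context, the rest of the list and the state: while
the list is not empty, `step` computes the next state from the context, the head of the list and
the present state. -/
def foldLoop (step : Prog) : Prog :=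
  .loop (.seq (.seq (.op .snd) (.op .fst)) (.op .isPair))
    (.both (.op .fst) (.both (.seq (.seq (.op .snd) (.op .fst)) (.op .snd))
      (.seq (.both (.op .fst) (.both (.seq (.seq (.op .snd) (.op .fst)) (.op .fst))
        (.seq (.op .snd) (.op .snd)))) step)))

/-- The fold loop is correct, and takes at most the time `T` of `step` plus a constant number of
copies of the context, the list and the state for each item, if `B` bounds the sizes of these. -/
theorem run_foldLoop {step : Prog} {c : γ} {f : σ → α → σ} {B T : ℕ} (hc : (enc c).size ≤ B)
    (l : List α) (s : σ) (hl : (enc l).size ≤ B)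
    (hs : ∀ l', l' <+: l → (enc (l'.foldl f s)).size ≤ B)
    (hstep : ∀ l' x, l' ++ [x] <+: l →
      ∃ t ≤ T, Run step (enc (c, x, l'.foldl f s)) (enc (f (l'.foldl f s) x)) t) :
    ∃ t ≤ (l.length + 1) * (T + 100 * (B + 1)),
      Run (foldLoop step) (enc (c, l, s)) (enc (c, ([] : List α), l.foldl f s)) t := by
  induction l generalizing s with
  | nil =>
    have h₁ := hs [] (List.prefix_refl _)
    refine ⟨_, ?_, .loopStop (.seq (.seq (.op .snd _) (.op .fst _)) (.op .isPair _))⟩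
    simp only [Op.cost, size_enc_pair, size_enc_nil, List.length_nil]
    change _ + (1 + (enc ((([] : List α)), s)).size) + 1 + (1 + (enc (([] : List α))).size) + 1 +
      1 + _ ≤ _
    simp only [size_enc_pair, size_enc_nil]
    simp only [List.foldl_nil] at h₁
    omega
  | cons x l ih =>
    obtain ⟨t₁, ht₁, h₁⟩ := hstep [] x (by simp)
    obtain ⟨t₂, ht₂, h₂⟩ := ih (f s x) ((by rw [size_enc_cons]; omega : _ ≤ _).trans hl)
      (fun l' hl' => hs (x :: l') (List.cons_prefix_cons.2 ⟨rfl, hl'⟩))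
      (fun l' y hl' => hstep (x :: l') y (List.cons_prefix_cons.2 ⟨rfl, hl'⟩))
    have hs₀ := hs [] (by simp)
    have hl₀ := hl
    rw [size_enc_cons] at hl₀
    simp only [List.foldl_nil] at hs₀ h₁
    refine ⟨_, ?_, .loopStep (b := .num 1)
      (.seq (.seq (.op .snd _) (.op .fst _)) (.op .isPair _)) (by simp)
      (.both (.op .fst _) (.both (.seq (.seq (.op .snd _) (.op .fst _)) (.op .snd _))
        (.seq (.both (.op .fst _) (.both (.seq (.seq (.op .snd _) (.op .fst _)) (.op .fst _))
          (.seq (.op .snd _) (.op .snd _)))) h₁))) h₂⟩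
    simp only [Op.cost]
    change _ + (1 + (enc (x :: l, s)).size) + 1 + (1 + (enc (x :: l)).size) + 1 +
      (_ + (_ + (1 + (enc (x :: l, s)).size) + 1 + (1 + (enc (x :: l)).size) + 1 +
        (_ + (_ + (1 + (enc (x :: l, s)).size) + 1 + (1 + (enc (x :: l)).size) + 1 +
        (_ + (1 + (enc (x :: l, s)).size) + 1) + 1 + _) + 1 + _ + _ + 1) + 1 + _) + 1 + _) + _ + 1
        + _ ≤ _
    simp only [size_enc_pair, List.length_cons] at ht₂ ⊢
    rw [Nat.add_mul (l.length + 1) 1]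
    omega

/-- The reachable situations in the body of a loop that folds `f` over the list `l`: an instance,
an item of its list, and a state reached from `init` by folding over an initial segment. -/
structure FoldStep {I : Type} (l : I → List α) (init : I → σ) (f : I → σ → α → σ) where
  base : I
  item : α
  state : σ
  mem : item ∈ l base
  reach : ∃ l', l' <+: l base ∧ state = l'.foldl (f base) (init base)

/-- An instance together with an item of its list. -/
structure MapStep {I : Type} (l : I → List α) where
  base : I
  item : α
  mem : item ∈ l base

namespace PolyTime

variable {I : Type} {sz : I → ℕ} {e : I → γ}

/-- A fold takes polynomial time if its body does and the states keep polynomial size. The body may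
use the context, the item and the state. -/
theorem foldl {l : I → List α} {init : I → σ} {f : I → σ → α → σ} (hl : PolyTime sz e l)
    (hi : PolyTime sz e init) {B : I → ℕ} (hB : PolyBounded sz B)
    (hs : ∀ a l', l' <+: l a → (enc (l'.foldl (f a) (init a))).size ≤ B a)
    (hstep : ∀ src : FoldStep l init f → γ × α × σ,
      PolyTime (fun j => sz j.base) src (fun j => e j.base) →
      PolyTime (fun j => sz j.base) src (fun j => j.item) →
      PolyTime (fun j => sz j.base) src (fun j => j.state) →
      PolyTime (fun j => sz j.base) src (fun j => f j.base j.state j.item)) :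
    PolyTime sz e fun a => (l a).foldl (f a) (init a) := by
  have hsrc : PolyTime (I := FoldStep l init f) (fun j => sz j.base)
      (fun j => (e j.base, j.item, j.state)) (fun j => (e j.base, j.item, j.state)) := by
    refine refl (((((hl.source.comap FoldStep.base).add (hl.bounded.comap FoldStep.base)).add
      (hB.comap FoldStep.base)).add (.const 2)).mono fun j => ?_)
    obtain ⟨l', hl', hj⟩ := j.reach
    have h₁ := size_enc_le_of_mem j.mem
    have h₂ := hs j.base l' hl'
    rw [← hj] at h₂
    simp only [size_enc_pair]
    omega
  obtain ⟨step, t, ⟨P, hP⟩, -, hrun⟩ := hstep _ hsrc.fst hsrc.snd.fst hsrc.snd.snd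
  have hbound : PolyBounded sz fun a => (enc (e a)).size + (enc (l a)).size + B a :=
    (hl.source.add hl.bounded).add hB
  have hcfg : PolyTime sz e fun a => (e a, l a, init a) := (refl hl.source).pair (hl.pair hi)
  have hloop : ∀ a, ∃ t ≤ ((l a).length + 1) *
      (P.eval (sz a) + 100 * ((enc (e a)).size + (enc (l a)).size + B a + 1)),
      Run (foldLoop step) (enc (e a, l a, init a))
        (enc (e a, ([] : List α), (l a).foldl (f a) (init a))) t := by
    intro a
    refine run_foldLoop (by omega) _ _ (by omega) (fun l' hl' => (hs a l' hl').trans (by omega))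
      fun l' x hx => ?_
    exact ⟨_, hP ⟨a, x, _, hx.subset (by simp), l', (List.prefix_append _ _).trans hx, rfl⟩,
      hrun ⟨a, x, _, hx.subset (by simp), l', (List.prefix_append _ _).trans hx, rfl⟩⟩
  choose t' ht' hrun' using hloop
  have : PolyTime sz (fun a => (e a, l a, init a))
      (fun a => (e a, ([] : List α), (l a).foldl (f a) (init a))) := by
    refine ⟨foldLoop step, t', PolyBounded.mono ?_ ht', hcfg.bounded, hrun'⟩
    exact ((hl.bounded.mono fun a => length_le_size (l a)).add (.const 1)).mul
      (PolyBounded.add ⟨P, fun a => le_rfl⟩ ((PolyBounded.const 100).mul (hbound.add (.const 1))))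
  exact (hcfg.trans this).snd.snd

theorem reverse {l : I → List α} (hl : PolyTime sz e l) : PolyTime sz e fun a => (l a).reverse := by
  have key : ∀ l : List α, l.reverse = l.foldl (fun r x => x :: r) [] := fun l => by simp
  simp only [key]
  refine hl.foldl hl.nil hl.bounded (fun a l' hl' => ?_) fun src _ hx hr => hx.cons hr
  rw [← key, size_enc_reverse]
  exact size_enc_le_of_sublist hl'.sublist

theorem append {l l' : I → List α} (hl : PolyTime sz e l) (hl' : PolyTime sz e l') :
    PolyTime sz e fun a => l a ++ l' a := by
  have key : ∀ l l' : List α, l.reverse ++ l' = l.foldl (fun r x => x :: r) l' := fun l l' => by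
    simp
  have : PolyTime sz e fun a => (l a).reverse.foldl (fun r x => x :: r) (l' a) := by
    refine hl.reverse.foldl hl' (hl.bounded.add hl'.bounded) (fun a l₁ hl₁ => ?_)
      fun src _ hx hr => hx.cons hr
    have h₁ := size_enc_append l₁.reverse (l' a)
    have h₂ := size_enc_le_of_sublist hl₁.sublist
    rw [size_enc_reverse] at h₁ h₂
    rw [← key]
    omega
  exact this.congr fun a => by rw [← key, List.reverse_reverse]

/-- Mapping a polynomial-time function, which may depend on the context, over a list. -/
theorem map {l : I → List α} {g : I → α → β} (hl : PolyTime sz e l)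
    (hstep : ∀ src : MapStep l → γ × α,
      PolyTime (fun j => sz j.base) src (fun j => e j.base) →
      PolyTime (fun j => sz j.base) src (fun j => j.item) →
      PolyTime (fun j => sz j.base) src (fun j => g j.base j.item)) :
    PolyTime sz e fun a => (l a).map (g a) := by
  have hsrc : PolyTime (I := MapStep l) (fun j => sz j.base)
      (fun j => (e j.base, j.item)) (fun j => (e j.base, j.item)) := by
    refine refl ((((hl.source.comap MapStep.base).add (hl.bounded.comap MapStep.base)).add
      (.const 1)).mono fun j => ?_)
    have h₁ := size_enc_le_of_mem j.mem
    simp only [size_enc_pair]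
    omega
  have hg := hstep _ hsrc.fst hsrc.snd
  obtain ⟨P, hP⟩ := hg.bounded
  have key : ∀ a (l : List α), (l.map (g a)).reverse = l.foldl (fun r x => g a x :: r) [] := by
    intro a l
    simp [← List.map_reverse]
  have : PolyTime sz e fun a => (l a).foldl (fun r x => g a x :: r) [] := by
    refine hl.foldl hl.nil (B := fun a => 1 + (enc (l a)).size * (1 + P.eval (sz a)))
      ((PolyBounded.const 1).add (hl.bounded.mul ((PolyBounded.const 1).add ⟨P, fun _ => le_rfl⟩)))
      (fun a l' hl' => ?_) fun src he hx hr => ?_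
    · rw [← key, size_enc_reverse]
      refine (size_enc_le_of_forall (B := P.eval (sz a)) _ fun y hy => ?_).trans ?_
      · obtain ⟨x, hx, rfl⟩ := List.mem_map.1 hy
        exact hP ⟨a, x, hl'.subset hx⟩
      · rw [List.length_map]
        have := (length_le_size l').trans (size_enc_le_of_sublist hl'.sublist)
        gcongr
    · have h := hg.comap (J := FoldStep l (fun _ => []) fun a r x => g a x :: r)
        fun j => ⟨j.base, j.item, j.mem⟩
      exact ((he.pair hx).trans h).cons hr
  exact this.reverse.congr fun a => by rw [← key, List.reverse_reverse]

theorem flatten {l : I → List (List α)} (hl : PolyTime sz e l) :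
    PolyTime sz e fun a => (l a).flatten := by
  have key : ∀ l : List (List α), l.flatten = l.foldl (fun r x => r ++ x) [] := by
    intro l
    induction l using List.reverseRecOn with
    | nil => rfl
    | append_singleton l x ih => simp [← ih]
  have hsize : ∀ l : List (List α), (enc l.flatten).size ≤ (enc l).size := by
    intro l
    induction l with
    | nil => exact le_rfl
    | cons x l ih =>
      have := size_enc_append x l.flatten
      rw [List.flatten_cons, size_enc_cons]
      omega
  simp only [key]
  refine hl.foldl hl.nil hl.bounded (fun a l' hl' => ?_) fun src _ hx hr => hr.append hx
  rw [← key]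
  exact (hsize l').trans (size_enc_le_of_sublist hl'.sublist)

theorem filter {l : I → List α} {p : I → α → Prop} [∀ a, DecidablePred (p a)]
    (hl : PolyTime sz e l)
    (hstep : ∀ src : FoldStep l (fun _ => ([] : List α))
        (fun a r x => if p a x then x :: r else r) → γ × α × List α,
      PolyTime (fun j => sz j.base) src (fun j => e j.base) →
      PolyTime (fun j => sz j.base) src (fun j => j.item) →
      PolyTime (fun j => sz j.base) src (fun j => if p j.base j.item then (1 : ℤ) else 0)) :
    PolyTime sz e fun a => (l a).filter fun x => p a x := by
  have key : ∀ a (l r : List α), (l.filter fun x => p a x).reverse ++ r =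
      l.foldl (fun r x => if p a x then x :: r else r) r := by
    intro a l
    induction l with
    | nil => simp
    | cons x l ih =>
      intro r
      by_cases h : p a x <;> simp [h, ← ih]
  have : PolyTime sz e fun a => (l a).foldl (fun r x => if p a x then x :: r else r) [] := by
    refine hl.foldl hl.nil hl.bounded (fun a l' hl' => ?_)
      fun src he hx hr => (hstep src he hx).ite (hx.cons hr) hr
    rw [← key, List.append_nil, size_enc_reverse]
    exact size_enc_le_of_sublist (List.filter_sublist.trans hl'.sublist)
  exact this.reverse.congr fun a => by rw [← key, List.append_nil, List.reverse_reverse]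

theorem sum {l : I → List ℤ} (hl : PolyTime sz e l) : PolyTime sz e fun a => (l a).sum := by
  have hsize : ∀ l : List ℤ, (enc l.sum).size ≤ (enc l).size := by
    intro l
    induction l with
    | nil => simp [size_enc_num, size_enc_nil]
    | cons x l ih =>
      have := Val.size_num_add_le x l.sum
      rw [size_enc_num] at ih
      rw [List.sum_cons, size_enc_cons, size_enc_num, size_enc_num]
      omega
  simp only [List.sum_eq_foldl]
  refine hl.foldl (hl.const 0) hl.bounded (fun a l' hl' => ?_) fun src _ hx hr => hr.add hx
  rw [← List.sum_eq_foldl]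
  exact (hsize l').trans (size_enc_le_of_sublist hl'.sublist)

theorem prod {l : I → List ℤ} (hl : PolyTime sz e l) : PolyTime sz e fun a => (l a).prod := by
  have hsize : ∀ l : List ℤ, (enc l.prod).size ≤ 1 + (enc l).size := by
    intro l
    induction l with
    | nil => simp [size_enc_num, size_enc_nil]
    | cons x l ih =>
      have := Val.size_num_mul_le x l.prod
      rw [size_enc_num] at ih
      rw [List.prod_cons, size_enc_cons, size_enc_num, size_enc_num]
      omega
  simp only [List.prod_eq_foldl]
  refine hl.foldl (hl.const 1) ((PolyBounded.const 1).add hl.bounded) (fun a l' hl' => ?_)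
    fun src _ hx hr => hr.mul hx
  rw [← List.prod_eq_foldl]
  exact (hsize l').trans (Nat.add_le_add_left (size_enc_le_of_sublist hl'.sublist) 1)

theorem length {l : I → List α} (hl : PolyTime sz e l) :
    PolyTime sz e fun a => ((l a).length : ℤ) :=
  (hl.map (g := fun _ _ => (1 : ℤ)) fun _ he _ => he.const 1).sum.congr fun a => by simp

/-- Counting up to the length of a list. -/
theorem range {l : I → List α} (hl : PolyTime sz e l) :
    PolyTime sz e fun a => (List.range (l a).length).map fun k : ℕ => (k : ℤ) := by
  have key : ∀ l : List α, ((List.range l.length).map fun k : ℕ => (k : ℤ)).reverse =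
      l.foldl (fun (r : List ℤ) _ => (r.length : ℤ) :: r) [] := by
    intro l
    induction l using List.reverseRecOn with
    | nil => simp
    | append_singleton l x ih =>
      simp [← ih, List.range_succ]
  have : PolyTime sz e fun a => (l a).foldl (fun (r : List ℤ) _ => (r.length : ℤ) :: r) [] := by
    refine hl.foldl hl.nil (B := fun a => 1 + (enc (l a)).size * (1 + (1 + (enc (l a)).size)))
      ((PolyBounded.const 1).add (hl.bounded.mul
        ((PolyBounded.const 1).add ((PolyBounded.const 1).add hl.bounded))))
      (fun a l' hl' => ?_) fun src _ _ hr => hr.length.cons hr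
    have h₁ := (length_le_size l').trans (size_enc_le_of_sublist hl'.sublist)
    rw [← key, size_enc_reverse]
    refine (size_enc_le_of_forall (B := 1 + (enc (l a)).size) _ fun y hy => ?_).trans ?_
    · obtain ⟨x, hx, rfl⟩ := List.mem_map.1 hy
      rw [size_enc_num, Int.natAbs_natCast, Nat.add_le_add_iff_left, Nat.size_le]
      exact (List.mem_range.1 hx).trans_le (h₁.trans Nat.lt_two_pow_self.le)
    · rw [List.length_map, List.length_range]
      gcongr
  exact this.reverse.congr fun a => by rw [← key, List.reverse_reverse]

theorem zip {l : I → List α} {l' : I → List β} (hl : PolyTime sz e l) (hl' : PolyTime sz e l')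
    (hlen : ∀ a, (l a).length = (l' a).length) : PolyTime sz e fun a => (l a).zip (l' a) := by
  -- The state is the rest of the second list and the reversed list of the pairs.
  let f : List Val × List (α × Val) → α → List Val × List (α × Val) :=
    fun s x => (s.1.tail, (x, s.1.headD (.num 0)) :: s.2)
  have key : ∀ (l : List α) (v : List Val) (r : List (α × Val)), l.length ≤ v.length →
      l.foldl f (v, r) = (v.drop l.length, (l.zip v).reverse ++ r) := by
    intro l
    induction l with
    | nil => simp
    | cons x l ih =>
      intro v r h
      rcases v with _ | ⟨y, v⟩
      · simp at h
      · simpa [f] using ih v ((x, y) :: r) (by simpa using h)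
  have hsize : ∀ (l : List α) (v : List Val),
      (enc (l.zip v)).size ≤ (enc l).size + (enc v).size := by
    intro l
    induction l with
    | nil => intro v; rw [List.zip_nil_left, size_enc_nil, size_enc_nil]; omega
    | cons x l ih =>
      intro v
      rcases v with _ | ⟨y, v⟩
      · rw [List.zip_nil_right, size_enc_nil, size_enc_cons]; omega
      · have := ih v
        rw [List.zip_cons_cons, size_enc_cons, size_enc_cons, size_enc_cons, size_enc_pair]
        omega
  have hv : PolyTime sz e fun a => (l' a).map (enc : β → Val) := hl'.congr fun a => by
    change Val.ofList _ = Val.ofList _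
    rw [List.map_map]
    rfl
  have : PolyTime sz e fun a => (l a).foldl f ((l' a).map enc, []) := by
    refine hl.foldl (hv.pair hv.nil) ((hv.bounded.add (hl.bounded.add hv.bounded)).add (.const 1))
      (fun a l₁ hl₁ => ?_)
      fun src _ hx hr => hr.fst.tail.pair ((hx.pair hr.fst.headD).cons hr.snd)
    have h₁ := size_enc_le_of_sublist hl₁.sublist
    have h₂ := size_enc_le_of_sublist (List.drop_sublist l₁.length ((l' a).map (enc : β → Val)))
    have h₃ := hsize l₁ ((l' a).map enc)
    rw [key _ _ _ (by rw [List.length_map, ← hlen]; exact hl₁.length_le), size_enc_pair,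
      List.append_nil, size_enc_reverse]
    omega
  refine this.snd.reverse.congr fun a => ?_
  rw [key _ _ _ (by rw [List.length_map, hlen]), List.append_nil, List.reverse_reverse,
    List.zip_map_right]
  change Val.ofList _ = Val.ofList _
  rw [List.map_map]
  rfl

end PolyTime
end lists

/-! ### Sparse products -/

section sparse

variable {G : Type}

/-- Adds the term `p` to a list of terms, merging it with the terms of the same exponent. A list of
terms (exponent, coefficient) stands for an element of the monoid algebra. -/
def insertTerm [DecidableEq G] (l : List (G × ℤ)) (p : G × ℤ) : List (G × ℤ) :=
  (p.1, p.2 + ((l.filter fun q => q.1 = p.1).map fun q => q.2).sum) ::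
    l.filter fun q => ¬ q.1 = p.1

/-- Merges the terms of equal exponents. -/
def collect [DecidableEq G] (l : List (G × ℤ)) : List (G × ℤ) := l.foldl insertTerm []

/-- The product of two lists of terms, with equal exponents merged. -/
def mulTerms [AddCommMonoid G] [DecidableEq G] (l l' : List (G × ℤ)) : List (G × ℤ) :=
  collect (l.map fun p => l'.map fun q => (p.1 + q.1, p.2 * q.2)).flatten

/-- The product of the monomial with exponent `κ` and of all the listed elements. -/
def prodTerms [AddCommMonoid G] [DecidableEq G] (κ : G) (L : List (List (G × ℤ))) : List (G × ℤ) := L.foldl mulTerms [(κ, 1)]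

theorem collect_append_singleton [DecidableEq G] (l : List (G × ℤ)) (p : G × ℤ) :
    collect (l ++ [p]) = insertTerm (collect l) p := by
  simp [collect]

theorem prodTerms_append_singleton [AddCommMonoid G] [DecidableEq G] (κ : G) (L : List (List (G × ℤ))) (l : List (G × ℤ)) :
    prodTerms κ (L ++ [l]) = mulTerms (prodTerms κ L) l := by
  simp [prodTerms]

/-- The sum of the absolute values of the coefficients. -/
def mass (l : List (G × ℤ)) : ℕ := (l.map fun q => q.2.natAbs).sum

theorem natAbs_list_sum_le (l : List ℤ) : l.sum.natAbs ≤ (l.map Int.natAbs).sum := by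
  induction l with
  | nil => simp
  | cons x l ih =>
    have := Int.natAbs_add_le x l.sum
    simp only [List.sum_cons, List.map_cons]
    omega

theorem sum_map_filter_add (l : List (G × ℤ)) (c : G × ℤ → Prop) [DecidablePred c]
    {M : Type} [AddCommMonoid M] (φ : G × ℤ → M) :
    ((l.filter fun q => c q).map φ).sum + ((l.filter fun q => ¬ c q).map φ).sum =
      (l.map φ).sum := by
  induction l with
  | nil => simp
  | cons x l ih =>
    by_cases h : c x
    · simp [h, ← ih, add_assoc]
    · simp [h, ← ih, add_left_comm]

theorem mass_insertTerm_le [DecidableEq G] (l : List (G × ℤ)) (p : G × ℤ) :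
    mass (insertTerm l p) ≤ mass l + p.2.natAbs := by
  have h₁ := sum_map_filter_add l (fun q => q.1 = p.1) fun q => q.2.natAbs
  have h₂ := natAbs_list_sum_le ((l.filter fun q => q.1 = p.1).map fun q => q.2)
  have h₃ := Int.natAbs_add_le p.2 ((l.filter fun q => q.1 = p.1).map fun q => q.2).sum
  rw [List.map_map] at h₂
  simp only [mass, insertTerm, List.map_cons, List.sum_cons, Function.comp_def] at *
  omega

theorem mass_collect_le [DecidableEq G] (l : List (G × ℤ)) : mass (collect l) ≤ mass l := by
  induction l using List.reverseRecOn with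
  | nil => exact le_rfl
  | append_singleton l p ih =>
    rw [collect_append_singleton]
    refine (mass_insertTerm_le _ _).trans ?_
    simpa [mass] using ih

theorem mass_mulTerms_le [AddCommMonoid G] [DecidableEq G] (l l' : List (G × ℤ)) : mass (mulTerms l l') ≤ mass l * mass l' := by
  refine (mass_collect_le _).trans (le_of_eq ?_)
  induction l with
  | nil => simp [mass]
  | cons p l ih =>
    simp only [mass, List.map_cons, List.flatten_cons, List.map_append, List.sum_append,
      List.sum_cons, add_mul, List.map_map, Function.comp_def, Int.natAbs_mul] at ih ⊢
    rw [ih, List.sum_map_mul_left]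

theorem length_collect_le [DecidableEq G] (l : List (G × ℤ)) : (collect l).length ≤ l.length := by
  induction l using List.reverseRecOn with
  | nil => exact le_rfl
  | append_singleton l p ih =>
    rw [collect_append_singleton, List.length_append]
    exact Nat.succ_le_succ ((List.length_filter_le _ _).trans ih)

theorem exists_of_mem_collect [DecidableEq G] {l : List (G × ℤ)} {p : G × ℤ} (hp : p ∈ collect l) :
    ∃ q ∈ l, q.1 = p.1 := by
  induction l using List.reverseRecOn with
  | nil => simp [collect] at hp
  | append_singleton l q ih =>
    rw [collect_append_singleton, insertTerm, List.mem_cons] at hp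
    rcases hp with rfl | hp
    · exact ⟨q, by simp, rfl⟩
    · obtain ⟨r, hr, h⟩ := ih (List.mem_of_mem_filter hp)
      exact ⟨r, by simp [hr], h⟩

theorem exists_of_mem_mulTerms [AddCommMonoid G] [DecidableEq G] {l l' : List (G × ℤ)} {p : G × ℤ} (hp : p ∈ mulTerms l l') :
    ∃ q ∈ l, ∃ q' ∈ l', p.1 = q.1 + q'.1 := by
  obtain ⟨r, hr, h⟩ := exists_of_mem_collect hp
  simp only [List.mem_flatten, List.mem_map] at hr
  obtain ⟨_, ⟨q, hq, rfl⟩, hr⟩ := hr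
  obtain ⟨q', hq', rfl⟩ := List.mem_map.1 hr
  exact ⟨q, hq, q', hq', h.symm⟩

theorem nodup_collect [DecidableEq G] (l : List (G × ℤ)) : ((collect l).map Prod.fst).Nodup := by
  induction l using List.reverseRecOn with
  | nil => simp [collect]
  | append_singleton l q ih =>
    rw [collect_append_singleton, insertTerm, List.map_cons, List.nodup_cons]
    refine ⟨by simp, ih.sublist (List.filter_sublist.map _)⟩

theorem nodup_prodTerms [AddCommMonoid G] [DecidableEq G] (κ : G) (L : List (List (G × ℤ))) :
    ((prodTerms κ L).map Prod.fst).Nodup := by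
  induction L using List.reverseRecOn with
  | nil => simp [prodTerms]
  | append_singleton L l ih =>
    rw [prodTerms_append_singleton]
    exact nodup_collect _

theorem mass_prodTerms_le [AddCommMonoid G] [DecidableEq G] (κ : G) {M : ℕ} (L : List (List (G × ℤ))) (hL : ∀ l ∈ L, mass l ≤ M) :
    mass (prodTerms κ L) ≤ M ^ L.length := by
  induction L using List.reverseRecOn with
  | nil => simp [prodTerms, mass]
  | append_singleton L l ih =>
    rw [prodTerms_append_singleton, List.length_append, List.length_singleton, pow_succ]
    exact (mass_mulTerms_le _ _).trans
      (Nat.mul_le_mul (ih fun l' h => hL l' (by simp [h])) (hL l (by simp)))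

/-- The element of the monoid algebra that a list of terms stands for. -/
noncomputable def toAlg (l : List (G × ℤ)) : AddMonoidAlgebra ℚ G :=
  (l.map fun p => AddMonoidAlgebra.single p.1 (p.2 : ℚ)).sum

theorem toAlg_cons (p : G × ℤ) (l : List (G × ℤ)) :
    toAlg (p :: l) = AddMonoidAlgebra.single p.1 (p.2 : ℚ) + toAlg l := by
  simp [toAlg]

theorem toAlg_append (l l' : List (G × ℤ)) : toAlg (l ++ l') = toAlg l + toAlg l' := by
  simp [toAlg]

theorem toAlg_insertTerm [DecidableEq G] (l : List (G × ℤ)) (p : G × ℤ) :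
    toAlg (insertTerm l p) = toAlg l + AddMonoidAlgebra.single p.1 (p.2 : ℚ) := by
  have h₁ := sum_map_filter_add l (fun q => q.1 = p.1)
    fun q => (AddMonoidAlgebra.single q.1 (q.2 : ℚ) : AddMonoidAlgebra ℚ G)
  have h₂ : ∀ l : List (G × ℤ), (∀ q ∈ l, q.1 = p.1) →
      (l.map fun q => (AddMonoidAlgebra.single q.1 (q.2 : ℚ) : AddMonoidAlgebra ℚ G)).sum =
        AddMonoidAlgebra.single p.1 (((l.map fun q => q.2).sum : ℤ) : ℚ) := by
    intro l
    induction l with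
    | nil => simp
    | cons q l ih =>
      intro h
      rw [List.map_cons, List.sum_cons, ih fun q hq => h q (by simp [hq]), h q (by simp),
        List.map_cons, List.sum_cons, Int.cast_add, AddMonoidAlgebra.single_add]
  rw [h₂ _ (by simp)] at h₁
  rw [insertTerm, toAlg_cons, Int.cast_add, AddMonoidAlgebra.single_add, toAlg, toAlg, ← h₁]
  abel

theorem toAlg_collect [DecidableEq G] (l : List (G × ℤ)) : toAlg (collect l) = toAlg l := by
  induction l using List.reverseRecOn with
  | nil => rfl
  | append_singleton l p ih =>
    rw [collect_append_singleton, toAlg_insertTerm, ih, toAlg_append, toAlg_cons]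
    simp [toAlg]

theorem toAlg_mulTerms [AddCommMonoid G] [DecidableEq G] (l l' : List (G × ℤ)) : toAlg (mulTerms l l') = toAlg l * toAlg l' := by
  rw [mulTerms, toAlg_collect]
  induction l with
  | nil => simp [toAlg]
  | cons p l ih =>
    rw [List.map_cons, List.flatten_cons, toAlg_append, ih, toAlg_cons, add_mul]
    congr 1
    simp only [toAlg, List.map_map, Function.comp_def, ← List.sum_map_mul_left,
      AddMonoidAlgebra.single_mul_single, Int.cast_mul]

theorem toAlg_prodTerms [AddCommMonoid G] [DecidableEq G] (κ : G) (L : List (List (G × ℤ))) :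
    toAlg (prodTerms κ L) = AddMonoidAlgebra.single κ 1 * (L.map toAlg).prod := by
  induction L using List.reverseRecOn with
  | nil => simp [prodTerms, toAlg]
  | append_singleton L l ih =>
    simp [prodTerms_append_singleton, toAlg_mulTerms, ih, mul_assoc]

/-- The linear functional on the monoid algebra that takes the value `h κ` at the monomial with
exponent `κ`. -/
noncomputable def functional (h : G → ℚ) : AddMonoidAlgebra ℚ G →ₗ[ℚ] ℚ :=
  Finsupp.linearCombination ℚ h ∘ₗ (AddMonoidAlgebra.coeffLinearEquiv ℚ).toLinearMap

theorem functional_single (h : G → ℚ) (κ : G) (w : ℚ) :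
    functional h (AddMonoidAlgebra.single κ w) = w * h κ := by
  simp [functional]

theorem functional_toAlg (h : G → ℚ) (l : List (G × ℤ)) :
    functional h (toAlg l) = (l.map fun p => (p.2 : ℚ) * h p.1).sum := by
  induction l with
  | nil => simp [toAlg]
  | cons p l ih => simp [toAlg_cons, ih, functional_single]

/-- The distribution of a sum of independent choices is the product of the distributions. -/
theorem sum_piFinset_eq_functional [AddCommMonoid G] {ι τ : Type} [Fintype ι] [DecidableEq ι] (h : G → ℚ) (κ : G)
    (T : ι → Finset τ) (w : ι → τ → ℚ) (δ : ι → τ → G) :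
    ∑ z ∈ Fintype.piFinset T, (∏ i, w i (z i)) * h (κ + ∑ i, δ i (z i)) =
      functional h (AddMonoidAlgebra.single κ 1 *
        ∏ i, ∑ v ∈ T i, AddMonoidAlgebra.single (δ i v) (w i v)) := by
  rw [Finset.prod_univ_sum, Finset.mul_sum, map_sum]
  refine Finset.sum_congr rfl fun z _ => ?_
  rw [AddMonoidAlgebra.prod_single, AddMonoidAlgebra.single_mul_single, functional_single, one_mul]

theorem size_sum_le {α : Type} [Datum α] (φ : α → ℕ) (hφ : ∀ x, Nat.size (φ x) ≤ (enc x).size)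
    (l : List α) : Nat.size (l.map φ).sum ≤ (enc l).size := by
  induction l with
  | nil => simp
  | cons x l ih =>
    have h₁ := hφ x
    have h₂ := size_add_le (φ x) (l.map φ).sum
    rw [List.map_cons, List.sum_cons, size_enc_cons]
    omega

theorem size_mass_le [Datum G] (l : List (G × ℤ)) : Nat.size (mass l) ≤ (enc l).size :=
  size_sum_le (fun q : G × ℤ => q.2.natAbs)
    (fun q => by
      change _ ≤ 1 + _ + (1 + Nat.size q.2.natAbs)
      omega) l

theorem natAbs_le_mass {l : List (G × ℤ)} {p : G × ℤ} (hp : p ∈ l) : p.2.natAbs ≤ mass l :=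
  List.single_le_sum (by simp) _ (List.mem_map_of_mem hp)

theorem size_collect_le [DecidableEq G] [Datum G] (l : List (G × ℤ)) :
    (enc (collect l)).size ≤ 1 + (enc l).size * (3 + 2 * (enc l).size) := by
  refine (size_enc_le_of_forall (B := 2 + 2 * (enc l).size) _ fun p hp => ?_).trans ?_
  · obtain ⟨q, hq, hqp⟩ := exists_of_mem_collect hp
    have h₁ := size_enc_le_of_mem hq
    have h₂ := (Nat.size_le_size ((natAbs_le_mass hp).trans (mass_collect_le l))).trans
      (size_mass_le l)
    rw [show q = (q.1, q.2) from rfl, size_enc_pair] at h₁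
    rw [show p = (p.1, p.2) from rfl, size_enc_pair, size_enc_num, ← hqp]
    omega
  · have := (length_collect_le l).trans (length_le_size l)
    rw [← add_assoc]
    gcongr

end sparse

/-! ### Sparse products in pseudo-polynomial time -/

section

variable {I γ : Type} [Datum γ] {sz : I → ℕ} {e : I → γ}

namespace PolyTime

theorem eqPair {x y : I → ℤ × ℤ} (hx : PolyTime sz e x) (hy : PolyTime sz e y) :
    PolyTime sz e fun a => if x a = y a then (1 : ℤ) else 0 :=
  ((hx.fst.eq hy.fst).and (hx.snd.eq hy.snd)).congr fun a => by simp only [Prod.ext_iff]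

theorem insertTerm {l : I → List ((ℤ × ℤ) × ℤ)} {p : I → (ℤ × ℤ) × ℤ} (hl : PolyTime sz e l)
    (hp : PolyTime sz e p) : PolyTime sz e fun a => insertTerm (l a) (p a) :=
  have h₁ := hl.filter (p := fun a (q : (ℤ × ℤ) × ℤ) => q.1 = (p a).1) fun _ he hq =>
    hq.fst.eqPair (hp.fst.weaken he)
  have h₂ := h₁.map (g := fun _ (q : (ℤ × ℤ) × ℤ) => q.2) fun _ _ hq => hq.snd
  have h₃ := hl.filter (p := fun a (q : (ℤ × ℤ) × ℤ) => ¬ q.1 = (p a).1) fun _ he hq =>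
    (hq.fst.eqPair (hp.fst.weaken he)).not
  (hp.fst.pair (hp.snd.add h₂.sum)).cons h₃

theorem collect {l : I → List ((ℤ × ℤ) × ℤ)} (hl : PolyTime sz e l) :
    PolyTime sz e fun a => collect (l a) := by
  refine hl.foldl hl.nil (B := fun a => 1 + (enc (l a)).size * (3 + 2 * (enc (l a)).size))
    ((PolyBounded.const 1).add (hl.bounded.mul
      ((PolyBounded.const 3).add ((PolyBounded.const 2).mul hl.bounded))))
    (fun a l' hl' => (size_collect_le l').trans ?_) fun _ _ hx hr => hr.insertTerm hx
  have := size_enc_le_of_sublist hl'.sublist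
  gcongr

theorem mulTerms {l l' : I → List ((ℤ × ℤ) × ℤ)} (hl : PolyTime sz e l) (hl' : PolyTime sz e l') :
    PolyTime sz e fun a => mulTerms (l a) (l' a) :=
  have h := hl.map (g := fun a p => (l' a).map fun q => (p.1 + q.1, p.2 * q.2)) fun _ he hp =>
    (hl'.weaken he).map (g := fun j q => (j.item.1 + q.1, j.item.2 * q.2)) fun _ he' hq =>
      (((hp.weaken he').fst.fst.add hq.fst.fst).pair
        ((hp.weaken he').fst.snd.add hq.fst.snd)).pair
        ((hp.weaken he').snd.mul hq.snd)
  h.flatten.collect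

end PolyTime

/-- The sum of the absolute values of the first components of the exponents. -/
def keySum (l : List ((ℤ × ℤ) × ℤ)) : ℕ := (l.map fun q => q.1.1.natAbs).sum

/-- The exponents that occur in a product are multiples of a common unit, and bounded. -/
theorem prodTerms_exponents {κ : ℤ} {u : ℕ} (hκ : (u : ℤ) ∣ κ) (L : List (List ((ℤ × ℤ) × ℤ)))
    (hL : ∀ l ∈ L, ∀ q ∈ l, (u : ℤ) ∣ q.1.1 ∧ 0 ≤ q.1.2 ∧ q.1.2 ≤ 1) :
    ∀ p ∈ prodTerms (κ, 0) L, (u : ℤ) ∣ p.1.1 ∧ p.1.1.natAbs ≤ κ.natAbs + (L.map keySum).sum ∧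
      0 ≤ p.1.2 ∧ p.1.2 ≤ L.length := by
  induction L using List.reverseRecOn with
  | nil => simp [prodTerms, hκ]
  | append_singleton L l ih =>
    intro p hp
    rw [prodTerms_append_singleton] at hp
    obtain ⟨q, hq, q', hq', h⟩ := exists_of_mem_mulTerms hp
    obtain ⟨h₁, h₂, h₃, h₄⟩ := ih (fun l' h => hL l' (by simp [h])) q hq
    obtain ⟨h₁', h₃', h₄'⟩ := hL l (by simp) q' hq'
    have h₂' : q'.1.1.natAbs ≤ keySum l := List.single_le_sum (by simp) _
      (List.mem_map_of_mem (f := fun q : (ℤ × ℤ) × ℤ => q.1.1.natAbs) hq')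
    have h₅ := Int.natAbs_add_le q.1.1 q'.1.1
    rw [h]
    refine ⟨dvd_add h₁ h₁', ?_, ?_, ?_⟩
    · simp only [Prod.fst_add, List.map_append, List.sum_append, List.map_cons, List.map_nil,
        List.sum_singleton]
      omega
    · simp only [Prod.snd_add]
      omega
    · simp only [Prod.snd_add, List.length_append, List.length_singleton, Nat.cast_add,
        Nat.cast_one]
      omega

/-- There are few different exponents, which is the reason for the pseudo-polynomial time. -/
theorem length_prodTerms_le {κ : ℤ} {u N : ℕ} (hu : 0 < u) (hκ : (u : ℤ) ∣ κ)
    (L : List (List ((ℤ × ℤ) × ℤ)))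
    (hL : ∀ l ∈ L, ∀ q ∈ l, (u : ℤ) ∣ q.1.1 ∧ 0 ≤ q.1.2 ∧ q.1.2 ≤ 1)
    (hN : κ.natAbs + (L.map keySum).sum ≤ u * N) :
    (prodTerms (κ, 0) L).length ≤ (2 * N + 1) * (L.length + 1) := by
  have hsub : ((prodTerms (κ, 0) L).map Prod.fst).toFinset ⊆
      ((Finset.Icc (-N : ℤ) N).image fun m => (u : ℤ) * m) ×ˢ Finset.Icc (0 : ℤ) L.length := by
    intro k hk
    simp only [List.mem_toFinset, List.mem_map] at hk
    obtain ⟨p, hp, rfl⟩ := hk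
    obtain ⟨⟨m, hm⟩, h₂, h₃, h₄⟩ := prodTerms_exponents hκ L hL p hp
    have h₅ : m.natAbs ≤ N := by
      rw [hm, Int.natAbs_mul, Int.natAbs_natCast] at h₂
      exact Nat.le_of_mul_le_mul_left (h₂.trans hN) hu
    rw [Finset.mem_product, Finset.mem_image, Finset.mem_Icc]
    exact ⟨⟨m, Finset.mem_Icc.2 (by omega), hm.symm⟩, h₃, h₄⟩
  have h := Finset.card_le_card hsub
  rw [List.toFinset_card_of_nodup (nodup_prodTerms _ _), List.length_map,
    Finset.card_product] at h
  refine h.trans (Nat.mul_le_mul (Finset.card_image_le.trans ?_) ?_) <;> rw [Int.card_Icc] <;> omega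

theorem size_keySum_le (l : List ((ℤ × ℤ) × ℤ)) : Nat.size (keySum l) ≤ (enc l).size :=
  size_sum_le _ (fun q => by
    change _ ≤ 1 + (1 + (1 + Nat.size q.1.1.natAbs) + _) + _
    omega) l

/-- A product is computed in polynomial time if the exponents that occur are, up to a common unit,
bounded by a polynomial. -/
theorem PolyTime.prodTerms {κ : I → ℤ} {L : I → List (List ((ℤ × ℤ) × ℤ))} {u N : I → ℕ}
    (hκ : PolyTime sz e κ) (hL : PolyTime sz e L) (hN : PolyBounded sz N) (hu : ∀ a, 0 < u a)
    (hκu : ∀ a, (u a : ℤ) ∣ κ a)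
    (hLu : ∀ a, ∀ l ∈ L a, ∀ q ∈ l, (u a : ℤ) ∣ q.1.1 ∧ 0 ≤ q.1.2 ∧ q.1.2 ≤ 1)
    (hle : ∀ a, (κ a).natAbs + ((L a).map keySum).sum ≤ u a * N a) :
    PolyTime sz e fun a => prodTerms (κ a, 0) (L a) := by
  have hs : PolyBounded sz fun a => (enc (L a)).size := hL.bounded
  have hone : PolyBounded sz fun _ => 1 := .const 1
  refine hL.foldl (((hκ.pair (hκ.const (0 : ℤ))).pair (hκ.const (1 : ℤ))).cons hκ.nil)
    (B := fun a => 1 + ((2 * N a + 1) * ((enc (L a)).size + 1)) * (1 +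
      (6 + ((enc (κ a)).size + (enc (L a)).size) + (enc (L a)).size +
        (enc (L a)).size * (enc (L a)).size)))
    (hone.add (((((PolyBounded.const 2).mul hN).add hone).mul (hs.add hone)).mul (hone.add
      ((((PolyBounded.const 6).add (hκ.bounded.add hs)).add hs).add (hs.mul hs)))))
    (fun a l' hl' => ?_) fun _ _ hx hr => hr.mulTerms hx
  have hsub : ((l').map keySum).sum ≤ ((L a).map keySum).sum :=
    (hl'.sublist.map _).sum_le_sum (by simp)
  have hlen := (length_le_size l').trans (size_enc_le_of_sublist hl'.sublist)
  have hl'u : ∀ l ∈ l', ∀ q ∈ l, (u a : ℤ) ∣ q.1.1 ∧ 0 ≤ q.1.2 ∧ q.1.2 ≤ 1 :=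
    fun l hl => hLu a l (hl'.subset hl)
  have hle' : (κ a).natAbs + (l'.map keySum).sum ≤ u a * N a := by
    have := hle a
    omega
  change (enc (GamExplain.prodTerms (κ a, 0) l')).size ≤ _
  refine (size_enc_le_of_forall (B := 6 + ((enc (κ a)).size + (enc (L a)).size) +
    (enc (L a)).size + (enc (L a)).size * (enc (L a)).size) _ fun p hp => ?_).trans ?_
  · obtain ⟨-, h₂, h₃, h₄⟩ := prodTerms_exponents (hκu a) l' hl'u p hp
    -- The mass is submultiplicative, so the bit length of the weights grows linearly.
    have hm : mass (GamExplain.prodTerms (κ a, 0) l') ≤ (2 ^ (enc (L a)).size) ^ l'.length := by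
      refine mass_prodTerms_le _ _ fun l hl => ?_
      refine (Nat.lt_size_self _).le.trans (Nat.pow_le_pow_right (by simp) ?_)
      exact (size_mass_le l).trans (size_enc_le_of_mem (hl'.subset hl))
    have h₅ : Nat.size p.2.natAbs ≤ (enc (L a)).size * (enc (L a)).size + 1 := by
      rw [Nat.size_le]
      refine ((natAbs_le_mass hp).trans hm).trans_lt ?_
      rw [← pow_mul]
      exact Nat.pow_lt_pow_right (by simp) (Nat.lt_succ_of_le (by gcongr))
    have h₆ : Nat.size p.1.2.natAbs ≤ (enc (L a)).size := by
      rw [Nat.size_le]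
      exact (by omega : _ ≤ (enc (L a)).size).trans_lt Nat.lt_two_pow_self
    have h₇ : Nat.size p.1.1.natAbs ≤ (enc (κ a)).size + (enc (L a)).size := by
      refine (Nat.size_le_size (h₂.trans (Nat.add_le_add_left hsub _))).trans
        ((size_add_le _ _).trans (Nat.add_le_add ?_ (size_sum_le keySum size_keySum_le _)))
      rw [size_enc_num]
      omega
    change 1 + (1 + (1 + Nat.size p.1.1.natAbs) + (1 + Nat.size p.1.2.natAbs)) +
      (1 + Nat.size p.2.natAbs) ≤ _
    omega
  · have := length_prodTerms_le (hu a) (hκu a) l' hl'u hle'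
    have h' : (2 * N a + 1) * (l'.length + 1) ≤ (2 * N a + 1) * ((enc (L a)).size + 1) := by
      gcongr
    gcongr
    exact this.trans h'

end

/-! ### Integer keys for the weighted component values -/

section

variable {I γ : Type} [Datum γ] {sz : I → ℕ} {e : I → γ}

theorem PolyTime.of_bounded {α : Type} [Datum α] {sz' : I → ℕ} {g : I → α}
    (h : PolyTime sz' e g) (hsz : PolyBounded sz sz') : PolyTime sz e g := by
  obtain ⟨f, t, ht, he, h⟩ := h
  exact ⟨f, t, hsz.trans ht, hsz.trans he, h⟩

theorem zip_ofFn {α β : Type} {n : ℕ} (f : Fin n → α) (g : Fin n → β) :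
    (List.ofFn f).zip (List.ofFn g) = List.ofFn fun i => (f i, g i) := by
  apply List.ext_getElem <;> simp

/-- Inference as a polynomial-time function to fractions. Outside the domain of a component, where
the inference program need not halt, the fraction is not claimed to be computable. -/
theorem exists_fraction {C : ComponentKind} (hC : C.PolyTimeInference) :
    ∃ val : Val → ℚ → ℤ × ℤ, (∀ c v, 0 < (val c v).2) ∧
      (∀ c, ∀ v ∈ C.domain c, ((val c v).1 : ℚ) / ((val c v).2 : ℚ) = C.value c v) ∧
      PolyTime (I := {p : Val × ℚ // p.2 ∈ C.domain p.1}) (fun p => (enc p.1).size)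
        (fun p => p.1) (fun p => val p.1.1 p.1.2) := by
  obtain ⟨f, P, hf⟩ := hC
  have hf' : ∀ c v, ∃ q : ℤ × ℤ, 0 < q.2 ∧ (v ∈ C.domain c → (q.1 : ℚ) / (q.2 : ℚ) = C.value c v ∧
      ∃ t, Run f (enc (c, v)) (enc q) t ∧ t ≤ P.eval (enc (c, v)).size) := by
    intro c v
    by_cases h : v ∈ C.domain c
    · obtain ⟨_, t, hrun, ⟨a, b, hb, rfl, hab⟩, ht⟩ := hf c v h
      exact ⟨(a, b), hb, fun _ => ⟨hab, t, hrun, ht⟩⟩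
    -- Outside the domain, any fraction with a positive denominator will do.
    · exact ⟨(0, 1), one_pos, fun h' => absurd h' h⟩
  choose val hpos hval using hf'
  choose hval t hrun ht using hval
  exact ⟨val, hpos, hval, f, fun p => t p.1.1 p.1.2 p.2, ⟨P, fun p => ht p.1.1 p.1.2 p.2⟩, .self,
    fun p => hrun p.1.1 p.1.2 p.2⟩

/-- The multiple `D * q` of a fraction `q` whose denominator divides `D`. -/
def scale (D : ℤ) (q : ℤ × ℤ) : ℤ := q.1 * (D / q.2)

theorem scale_cast {D : ℤ} {q : ℤ × ℤ} (hq : 0 < q.2) (h : q.2 ∣ D) :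
    (scale D q : ℚ) = D * ((q.1 : ℚ) / (q.2 : ℚ)) := by
  have : (q.2 : ℚ) ≠ 0 := by exact_mod_cast hq.ne'
  rw [scale, Int.cast_mul, Int.cast_div h this]
  field_simp

theorem PolyTime.scale {D : I → ℤ} {q : I → ℤ × ℤ} (hD : PolyTime sz e D) (hq : PolyTime sz e q) :
    PolyTime sz e fun a => scale (D a) (q a) := hq.fst.mul (hD.div hq.snd)

/-- The weighted component values of the models `g a`, multiplied by a common denominator, can be
computed in polynomial time. The denominator `D` is the product of all the denominators that come
up in the inference, which need not be reduced; it is a multiple of the least common one. -/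
theorem exists_keys {C : ComponentKind} (hC : C.PolyTimeInference) {n : I → ℕ}
    {g : ∀ a, GAM C (n a)} {x : ∀ a, Fin (n a) → ℚ} (hx : ∀ a i, x a i ∈ (g a).X i)
    (hg : PolyTime sz e fun a => (g a).encode) (hx' : PolyTime sz e fun a => List.ofFn (x a)) :
    ∃ (D κ : I → ℤ) (key : ∀ a, Fin (n a) → ℚ → ℤ), (∀ a, 0 < D a) ∧
      (∀ a, (κ a : ℚ) = D a * (g a).β₀) ∧
      (∀ a i, ∀ v ∈ (g a).X i, (key a i v : ℚ) = D a * ((g a).β i * (g a).f i v)) ∧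
      PolyTime sz e κ ∧
      PolyTime sz e fun a => List.ofFn fun i => (key a i (x a i), ((g a).X i).map (key a i)) := by
  obtain ⟨val, hpos, hval, hinf⟩ := exists_fraction hC
  let wf : ℚ × Val → ℚ → ℤ × ℤ :=
    fun r v => (r.1.num * (val r.2 v).1, r.1.den * (val r.2 v).2)
  have hwf : ∀ {J : Type} {sz' : J → ℕ} {δ : Type} [Datum δ] {e' : J → δ} {r : J → ℚ × Val}
      {v : J → ℚ}, (∀ j, v j ∈ C.domain (r j).2) → PolyTime sz' e' r → PolyTime sz' e' v →
      PolyTime sz' e' fun j => wf (r j) (v j) := by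
    intro J sz' δ _ e' r v hmem hr hv
    have h := (hr.snd.pair hv).trans
      ((hinf.comap fun j => ⟨((r j).2, v j), hmem j⟩).of_bounded (hr.snd.pair hv).bounded)
    exact (hr.fst.num.mul h.fst).pair (hr.fst.den.mul h.snd)
  have hwf0 : ∀ r v, 0 < (wf r v).2 := fun r v =>
    mul_pos (by exact_mod_cast r.1.den_pos) (hpos _ _)
  have hmodel : PolyTime sz e fun a => ((g a).β₀,
      List.ofFn fun i => ((g a).β i, (g a).comp i, (g a).X i)) := hg.congr fun a => by
    change Val.pair _ (Val.ofList _) = Val.pair _ (Val.ofList (List.map _ _))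
    rw [List.map_ofFn]
    rfl
  have hrows : PolyTime sz e fun a =>
      List.ofFn fun i => (((g a).β i, (g a).comp i, (g a).X i), x a i) :=
    (hmodel.snd.zip hx' fun a => by simp).congr fun a => by rw [zip_ofFn]
  have htable : PolyTime sz e fun a => List.ofFn fun i =>
      (wf ((g a).β i, (g a).comp i) (x a i), ((g a).X i).map (wf ((g a).β i, (g a).comp i))) := by
    refine (hrows.map (g := fun _ r => (wf (r.1.1, r.1.2.1) r.2,
      r.1.2.2.map (wf (r.1.1, r.1.2.1)))) fun src he hr => ?_).congr fun a => by
        rw [List.map_ofFn]; rfl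
    refine (hwf (fun j => ?_) (hr.fst.fst.pair hr.fst.snd.fst) hr.snd).pair
      (hr.fst.snd.snd.map fun src' he' hv => hwf (fun j => ?_)
        ((hr.weaken he').fst.fst.pair (hr.weaken he').fst.snd.fst) hv)
    · obtain ⟨i, hi⟩ := (List.mem_ofFn' _ _).1 j.mem
      rw [← hi]
      exact (g j.base).defined i _ (hx _ _)
    · obtain ⟨i, hi⟩ := (List.mem_ofFn' _ _).1 j.base.mem
      have := j.mem
      rw [← hi] at this ⊢
      exact (g j.base.base).defined i _ this
  let D : I → ℤ := fun a => (g a).β₀.den * ((List.ofFn fun i =>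
    (wf ((g a).β i, (g a).comp i) (x a i), ((g a).X i).map (wf ((g a).β i, (g a).comp i)))).map
      fun r => (r.2.map fun q => q.2).prod).prod
  have hD : PolyTime sz e D := hmodel.fst.den.mul
    (htable.map (g := fun _ r => (r.2.map fun q => q.2).prod) fun _ _ hr =>
      (hr.snd.map (g := fun _ q => q.2) fun _ _ hq => hq.snd).prod).prod
  have hD0 : ∀ a, 0 < D a := by
    refine fun a => mul_pos (by exact_mod_cast (g a).β₀.den_pos) (List.prod_pos ?_)
    simp only [List.map_ofFn, List.mem_ofFn', Set.mem_range, Function.comp_apply, List.map_map]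
    rintro _ ⟨i, rfl⟩
    refine List.prod_pos fun d hd => ?_
    obtain ⟨v, -, rfl⟩ := List.mem_map.1 hd
    exact hwf0 _ _
  have hdvd : ∀ a i, ∀ v ∈ (g a).X i, (wf ((g a).β i, (g a).comp i) v).2 ∣ D a := by
    refine fun a i v hv => Dvd.dvd.mul_left ?_ _
    refine dvd_trans (b := ((((g a).X i).map (wf ((g a).β i, (g a).comp i))).map
      fun q => q.2).prod) (List.dvd_prod ?_) (List.dvd_prod ?_)
    · exact List.mem_map_of_mem (List.mem_map_of_mem hv)
    · rw [List.map_ofFn, List.mem_ofFn']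
      exact ⟨i, rfl⟩
  refine ⟨D, fun a => scale (D a) ((g a).β₀.num, (g a).β₀.den),
    fun a i v => scale (D a) (wf ((g a).β i, (g a).comp i) v), hD0, fun a => ?_, fun a i v hv => ?_,
    hD.scale (hmodel.fst.num.pair hmodel.fst.den), ?_⟩
  · have : (0 : ℤ) < (g a).β₀.den := by exact_mod_cast (g a).β₀.den_pos
    refine (scale_cast (q := ((g a).β₀.num, ((g a).β₀.den : ℤ))) this
      (dvd_mul_right _ _)).trans ?_
    simp only [Int.cast_natCast, Rat.num_div_den]
    rfl
  · rw [scale_cast (hwf0 _ _) (hdvd a i v hv), GAM.f, ← hval _ _ ((g a).defined i v hv)]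
    simp only [wf, Int.cast_mul, Int.cast_natCast, mul_div_mul_comm, Rat.num_div_den]
  · refine (htable.map (g := fun a r => (scale (D a) r.1, r.2.map fun q => scale (D a) q))
      fun _ he hr => ((hD.weaken he).scale hr.fst).pair
        (hr.snd.map fun _ he' hq => ((hD.weaken he).weaken he').scale hq)).congr fun a => ?_
    rw [List.map_ofFn]
    simp only [Function.comp_def, List.map_map]

end

section

variable {C : ComponentKind} {n : ℕ} (g : GAM C n) {D κ : ℤ} {key : Fin n → ℚ → ℤ}

theorem eq_unit_mul_num {k u : ℤ} {d : ℕ} {r : ℚ} (hk : (k : ℚ) = D * r) (hD : D = u * d)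
    (hr : r.den ∣ d) : k = u * ((d : ℚ) * r).num := by
  obtain ⟨m, rfl⟩ := hr
  have h : ((r.den * m : ℕ) : ℚ) * r = ((m * r.num : ℤ) : ℚ) := by
    push_cast
    nth_rw 2 [← Rat.num_div_den r]
    field_simp
  rw [h, Rat.num_intCast]
  apply Int.cast_injective (α := ℚ)
  rw [hk, hD]
  push_cast at h ⊢
  linear_combination (u : ℚ) * h

/-- Up to a common unit `u`, the keys of a model have total size at most its magnitude. -/
theorem exists_unit (hD : 0 < D) (hκ : (κ : ℚ) = D * g.β₀)
    (hkey : ∀ i, ∀ v ∈ g.X i, (key i v : ℚ) = D * (g.β i * g.f i v)) :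
    ∃ u : ℕ, 0 < u ∧ (u : ℤ) ∣ κ ∧ (∀ i, ∀ v ∈ g.X i, (u : ℤ) ∣ key i v) ∧
      κ.natAbs + ∑ i, ((g.X i).map fun v => (key i v).natAbs).sum ≤ u * g.magnitude := by
  have hden : ∀ {k : ℤ} {r : ℚ}, (k : ℚ) = D * r → r.den ∣ D.natAbs := by
    intro k r h
    have hD' : (D : ℚ) ≠ 0 := by exact_mod_cast hD.ne'
    have hr : r = (k : ℚ) / (D : ℚ) := by rw [h]; field_simp
    have := Rat.den_dvd k D
    rw [← Int.natCast_dvd, hr]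
    rwa [← Rat.divInt_eq_div]
  have hcd : g.commonDen ∣ D.natAbs := by
    refine Nat.lcm_dvd (hden hκ) (Finset.lcm_dvd fun i _ => Finset.lcm_dvd fun v hv => ?_)
    exact hden (hkey i v (List.mem_toFinset.1 hv))
  obtain ⟨u, hu⟩ := hcd
  have hDu : D = (u : ℤ) * g.commonDen := by
    have := Int.natAbs_of_nonneg hD.le
    rw [← this, hu]
    push_cast
    ring
  have hκ' := eq_unit_mul_num hκ hDu (Nat.dvd_lcm_left _ _)
  have hkey' : ∀ i, ∀ v ∈ g.X i,
      key i v = u * ((g.commonDen : ℚ) * (g.β i * g.f i v)).num := by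
    intro i v hv
    refine eq_unit_mul_num (hkey i v hv) hDu ?_
    exact ((Finset.dvd_lcm (f := fun v => (g.β i * g.f i v).den)
      (List.mem_toFinset.2 hv)).trans (Finset.dvd_lcm (f := fun i =>
        (g.X i).toFinset.lcm fun v => (g.β i * g.f i v).den) (Finset.mem_univ i))).trans
      (Nat.dvd_lcm_right _ _)
  refine ⟨u, Nat.pos_of_ne_zero ?_, ⟨_, hκ'⟩, fun i v hv => ⟨_, hkey' i v hv⟩, le_of_eq ?_⟩
  · rintro rfl
    simp at hDu
    omega
  · rw [GAM.magnitude, Nat.mul_add, hκ', Int.natAbs_mul, Int.natAbs_natCast, Finset.mul_sum]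
    congr 1
    refine Finset.sum_congr rfl fun i _ => ?_
    rw [← List.sum_toFinset _ (g.nodup i), Finset.mul_sum]
    refine Finset.sum_congr rfl fun v hv => ?_
    rw [hkey' i v (List.mem_toFinset.1 hv), Int.natAbs_mul, Int.natAbs_natCast]

end

/-! ### The queries as linear functionals of products -/

section

variable {C : ComponentKind} {n : ℕ} (g : GAM C n) {D κ : ℤ} {key : Fin n → ℚ → ℤ}

/-- The keys have the sign of the score. -/
theorem classify_eq (hD : 0 < D) (hκ : (κ : ℚ) = D * g.β₀)
    (hkey : ∀ i, ∀ v ∈ g.X i, (key i v : ℚ) = D * (g.β i * g.f i v)) {z : Fin n → ℚ}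
    (hz : ∀ i, z i ∈ g.X i) :
    g.classify z = if 0 ≤ κ + ∑ i, key i (z i) then 1 else 0 := by
  have h : ((κ + ∑ i, key i (z i) : ℤ) : ℚ) = D * g.score z := by
    rw [GAM.score, mul_add, Finset.mul_sum, ← hκ, Int.cast_add, Int.cast_sum]
    congr 1
    exact Finset.sum_congr rfl fun i _ => hkey i _ (hz i)
  have hD' : (0 : ℚ) < D := by exact_mod_cast hD
  have : 0 ≤ g.score z ↔ 0 ≤ κ + ∑ i, key i (z i) := by
    rw [← mul_nonneg_iff_of_pos_left hD', ← h, Int.cast_nonneg_iff]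
  simp only [GAM.classify, this]

theorem pair_add_sum {ι : Type} (s : Finset ι) (c d : ι → ℤ) (κ k : ℤ) :
    (κ, k) + ∑ i ∈ s, (c i, d i) = (κ + ∑ i ∈ s, c i, k + ∑ i ∈ s, d i) := by
  ext <;> simp [Prod.fst_sum, Prod.snd_sum]

theorem toAlg_map {τ : Type} [DecidableEq τ] {G : Type} (l : List τ) (hl : l.Nodup)
    (t : τ → G × ℤ) : toAlg (l.map t) =
      ∑ v ∈ l.toFinset, AddMonoidAlgebra.single (t v).1 ((t v).2 : ℚ) := by
  rw [toAlg, List.map_map, ← List.sum_toFinset _ hl]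
  rfl

theorem sum_mul_indicator {G : Type} (l : List (G × ℤ)) (c : G → Prop) [DecidablePred c]
    (φ : G → ℤ) :
    (l.map fun p => (p.2 : ℚ) * (if c p.1 then (φ p.1 : ℚ) else 0)).sum =
      ((((l.filter fun p => c p.1).map fun p => p.2 * φ p.1).sum : ℤ) : ℚ) := by
  induction l with
  | nil => simp
  | cons p l ih =>
    rw [List.map_cons, List.sum_cons, ih]
    by_cases h : c p.1 <;> simp [h]

theorem sum_natAbs_key_le {i : Fin n} {v : ℚ} (hv : v ∈ g.X i) :
    (key i v).natAbs ≤ ((g.X i).map fun v => (key i v).natAbs).sum :=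
  List.single_le_sum (by simp) _ (List.mem_map_of_mem (f := fun v => (key i v).natAbs) hv)

/-- The choices in the count of completions: the given value for a feature in `S`, any value of its
domain for another feature. -/
def ccChoices (S : Finset (Fin n)) (x : Fin n → ℚ) (i : Fin n) : Finset ℚ :=
  if i ∈ S then {x i} else (g.X i).toFinset

theorem mem_of_mem_ccChoices {S : Finset (Fin n)} {x z : Fin n → ℚ} (hx : ∀ i, x i ∈ g.X i)
    (hz : z ∈ Fintype.piFinset (ccChoices g S x)) (i : Fin n) : z i ∈ g.X i := by
  have := Fintype.mem_piFinset.1 hz i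
  rw [ccChoices] at this
  split_ifs at this with h
  · rw [Finset.mem_singleton.1 this]
    exact hx i
  · exact List.mem_toFinset.1 this

theorem sum_completions (S : Finset (Fin n)) (x : Fin n → ℚ) (F : (Fin n → ℚ) → ℚ) :
    ∑ z ∈ g.completions S, F (GAM.combine S x z) =
      ∑ z ∈ Fintype.piFinset (ccChoices g S x), F z := by
  refine Finset.sum_bij' (fun z _ => GAM.combine S x z) (fun z _ i => z i) ?_ ?_ ?_ ?_ ?_
  · intro z hz
    refine Fintype.mem_piFinset.2 fun i => ?_
    by_cases h : i ∈ S
    · simp [ccChoices, GAM.combine, h]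
    · simpa [ccChoices, GAM.combine, h] using Fintype.mem_piFinset.1 hz ⟨i, h⟩
  · intro z hz
    refine Fintype.mem_piFinset.2 fun i => ?_
    have := Fintype.mem_piFinset.1 hz i
    rwa [ccChoices, if_neg i.2] at this
  · intro z hz
    ext ⟨i, h⟩
    simp [GAM.combine, h]
  · intro z hz
    ext i
    by_cases h : i ∈ S
    · have := Fintype.mem_piFinset.1 hz i
      rw [ccChoices, if_pos h, Finset.mem_singleton] at this
      simp [GAM.combine, h, this]
    · simp [GAM.combine, h]
  · intros
    rfl

/-- The terms of feature `i` in the count of completions. -/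
def ccTerms (key : Fin n → ℚ → ℤ) (S : Finset (Fin n)) (x : Fin n → ℚ) (i : Fin n) :
    List ((ℤ × ℤ) × ℤ) :=
  if i ∈ S then [((key i (x i), 0), 1)] else (g.X i).map fun v => ((key i v, 0), 1)

theorem toAlg_ccTerms (S : Finset (Fin n)) (x : Fin n → ℚ) (i : Fin n) :
    toAlg (ccTerms g key S x i) =
      ∑ v ∈ ccChoices g S x i, AddMonoidAlgebra.single (key i v, 0) 1 := by
  rw [ccTerms, ccChoices]
  split_ifs
  · simp [toAlg]
  · rw [toAlg_map _ (g.nodup i)]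
    simp

theorem functional_ccTerms (S : Finset (Fin n)) (x : Fin n → ℚ) (h : ℤ × ℤ → ℚ) :
    functional h (toAlg (prodTerms (κ, 0) (List.ofFn (ccTerms g key S x)))) =
      ∑ z ∈ Fintype.piFinset (ccChoices g S x), h (κ + ∑ i, key i (z i), 0) := by
  have := sum_piFinset_eq_functional h (κ, 0) (ccChoices g S x) (fun _ _ => 1)
    fun i v => (key i v, 0)
  simp only [Finset.prod_const_one, one_mul, pair_add_sum, Finset.sum_const_zero, add_zero] at this
  rw [this, toAlg_prodTerms, List.map_ofFn, List.prod_ofFn]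
  simp only [Function.comp_apply, toAlg_ccTerms]

/-- The completion count is read off from the product: the weights of the exponents with a
nonnegative score add up to the number of completions of class `1`, and all the weights to the
number of completions. -/
theorem completionCount_eq (hD : 0 < D) (hκ : (κ : ℚ) = D * g.β₀)
    (hkey : ∀ i, ∀ v ∈ g.X i, (key i v : ℚ) = D * (g.β i * g.f i v)) {x : Fin n → ℚ}
    (hx : ∀ i, x i ∈ g.X i) (S : Finset (Fin n)) {A : List ((ℤ × ℤ) × ℤ)} {P T : ℤ}
    (hA : A = prodTerms (κ, 0) (List.ofFn (ccTerms g key S x)))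
    (hP : P = ((A.filter fun p => 0 ≤ p.1.1).map fun p => p.2).sum)
    (hT : T = (A.map fun p => p.2).sum) :
    0 < T ∧ (((if 0 ≤ κ + ∑ i, key i (x i) then P else T - P : ℤ)) : ℚ) / (T : ℚ) =
      g.completionCount x S := by
  have hT' : (T : ℚ) = (g.completions S).card := by
    have h₁ := functional_toAlg (fun _ => 1) A
    rw [hA, functional_ccTerms, ← sum_completions g S x fun _ => 1, ← hA] at h₁
    simp only [mul_one, Finset.sum_const, nsmul_eq_mul] at h₁
    rw [h₁, hT, Int.cast_list_sum, List.map_map]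
    rfl
  have hP' : (P : ℚ) = ∑ z ∈ g.completions S, g.classify (GAM.combine S x z) := by
    have h₁ := functional_toAlg (fun κ => if 0 ≤ κ.1 then ((1 : ℤ) : ℚ) else 0) A
    rw [sum_mul_indicator A (fun κ => 0 ≤ κ.1) fun _ => 1] at h₁
    simp only [mul_one, ← hP] at h₁
    rw [sum_completions g S x, ← h₁, hA, functional_ccTerms]
    refine Finset.sum_congr rfl fun z hz => ?_
    rw [classify_eq g hD hκ hkey (mem_of_mem_ccChoices g hx hz), Int.cast_one]
  have hpos : 0 < (g.completions S).card := Finset.card_pos.2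
    ⟨fun i => x i, Fintype.mem_piFinset.2 fun i => List.mem_toFinset.2 (hx i)⟩
  refine ⟨by exact_mod_cast hT' ▸ (Nat.cast_pos.2 hpos : (0 : ℚ) < _), ?_⟩
  rw [GAM.completionCount, ← hT']
  congr 1
  rw [Finset.card_filter, Nat.cast_sum, classify_eq g hD hκ hkey hx]
  have h01 : ∀ z, g.classify z = 0 ∨ g.classify z = 1 := fun z => by
    rw [GAM.classify]
    split_ifs <;> simp
  split_ifs
  · rw [hP']
    refine Finset.sum_congr rfl fun z _ => ?_
    rcases h01 (GAM.combine S x z) with h | h <;> simp [h]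
  · rw [Int.cast_sub, hP', hT', Finset.card_eq_sum_ones, Nat.cast_sum, ← Finset.sum_sub_distrib]
    refine Finset.sum_congr rfl fun z _ => ?_
    rcases h01 (GAM.combine S x z) with h | h <;> simp [h]

/-- The generating element of the random key of feature `i`. -/
noncomputable def randomKey (key : Fin n → ℚ → ℤ) (p : Fin n → ℚ → ℚ) (i : Fin n) :
    AddMonoidAlgebra ℚ (ℤ × ℤ) :=
  ∑ v ∈ (g.X i).toFinset, AddMonoidAlgebra.single (key i v, 0) (p i v)

/-- The generating element of the key of feature `i` when the features in `S` are fixed. -/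
noncomputable def partialKey (key : Fin n → ℚ → ℤ) (p : Fin n → ℚ → ℚ) (x : Fin n → ℚ)
    (S : Finset (Fin n)) (i : Fin n) : AddMonoidAlgebra ℚ (ℤ × ℤ) :=
  if i ∈ S then AddMonoidAlgebra.single (key i (x i), 0) 1 else randomKey g key p i

theorem functional_partialKey {p : Fin n → ℚ → ℚ} (hp : g.IsProductDistribution p)
    (x : Fin n → ℚ) (S : Finset (Fin n)) (h : ℤ × ℤ → ℚ) (k : ℤ) :
    functional h (AddMonoidAlgebra.single (κ, k) 1 * ∏ i, partialKey g key p x S i) =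
      ∑ z ∈ g.inputs, GAM.prob p z * h (κ + ∑ i, key i (S.piecewise x z i), k) := by
  have := sum_piFinset_eq_functional h (κ, k) (fun i => (g.X i).toFinset) p
    fun i v => (key i (if i ∈ S then x i else v), 0)
  simp only [pair_add_sum, Finset.sum_const_zero, add_zero] at this
  rw [GAM.inputs]
  refine Eq.trans (congrArg _ (congrArg _ (Finset.prod_congr rfl fun i _ => ?_))) this.symm
  rw [partialKey]
  split_ifs with hi
  · rw [← (hp i).2, ← AddMonoidAlgebra.singleAddHom_apply, map_sum]
    rfl
  · rfl

/-- The conditional expectation, given the features in `S`, is the expectation over the other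
features, whether or not the condition is null. -/
theorem valueFunction_eq (hD : 0 < D) (hκ : (κ : ℚ) = D * g.β₀)
    (hkey : ∀ i, ∀ v ∈ g.X i, (key i v : ℚ) = D * (g.β i * g.f i v)) {x : Fin n → ℚ}
    (hx : ∀ i, x i ∈ g.X i) {p : Fin n → ℚ → ℚ} (hp : g.IsProductDistribution p)
    (S : Finset (Fin n)) :
    g.valueFunction p x S = ∑ z ∈ g.inputs, GAM.prob p z * g.classify (S.piecewise x z) := by
  have hagree : g.agreeing x S = Fintype.piFinset (ccChoices g S x) := by
    ext z
    simp only [GAM.agreeing, GAM.inputs, Finset.mem_filter, Fintype.mem_piFinset, ccChoices,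
      List.mem_toFinset]
    constructor
    · rintro ⟨h₁, h₂⟩ i
      split_ifs with h
      · exact Finset.mem_singleton.2 (h₂ i h)
      · exact List.mem_toFinset.2 (h₁ i)
    · refine fun h => ⟨fun i => ?_, fun i hi => ?_⟩
      · exact mem_of_mem_ccChoices g hx (Fintype.mem_piFinset.2 h) i
      · simpa [hi] using h i
  let c : ℚ := ∏ i, if i ∈ S then p i (x i) else 1
  have hnull : ∑ z ∈ g.agreeing x S, GAM.prob p z = c := by
    rw [hagree]
    simp only [GAM.prob]
    rw [← Finset.prod_univ_sum]
    refine Finset.prod_congr rfl fun i _ => ?_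
    rw [ccChoices]
    split_ifs
    · simp
    · exact (hp i).2
  have hsum : ∑ z ∈ g.agreeing x S, GAM.prob p z * g.classify z =
      c * ∑ z ∈ g.inputs, GAM.prob p z * g.classify (S.piecewise x z) := by
    let h : ℤ × ℤ → ℚ := fun k => if 0 ≤ k.1 then 1 else 0
    have h₁ := functional_partialKey (κ := κ) (key := key) g hp x S h 0
    have h₂ := sum_piFinset_eq_functional h (κ, 0) (ccChoices g S x) p fun i v => (key i v, 0)
    have h₃ : ∏ i, ∑ v ∈ ccChoices g S x i,
        (AddMonoidAlgebra.single (key i v, 0) (p i v) : AddMonoidAlgebra ℚ (ℤ × ℤ)) =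
        c • ∏ i, partialKey g key p x S i := by
      rw [← Finset.prod_smul]
      refine Finset.prod_congr rfl fun i _ => ?_
      rw [ccChoices, partialKey]
      split_ifs
      · simp
      · rw [one_smul, randomKey]
    rw [h₃, mul_smul_comm, map_smul, h₁, smul_eq_mul] at h₂
    simp only [pair_add_sum, Finset.sum_const_zero, add_zero] at h₂
    rw [hagree]
    refine Eq.trans (Finset.sum_congr rfl fun z hz => ?_) (h₂.trans (congrArg _
      (Finset.sum_congr rfl fun z hz => ?_)))
    · rw [classify_eq g hD hκ hkey (mem_of_mem_ccChoices g hx hz), GAM.prob]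
    · rw [classify_eq g hD hκ hkey fun i => ?_]
      by_cases hi : i ∈ S
      · simpa [hi] using hx i
      · simpa [hi] using List.mem_toFinset.1 (Fintype.mem_piFinset.1 hz i)
  rw [GAM.valueFunction, hsum, hnull]
  split_ifs with h0
  · rfl
  · rw [mul_div_cancel_left₀ _ h0]

/-- The terms of feature `j` in the Shapley value of feature `i`, with `Q` times the probabilities
as weights. The second component of the exponent counts the fixed features. A feature `j ≠ i` is
fixed or random; for `j = i`, the two cases have opposite signs. -/
def shapTerms (key : Fin n → ℚ → ℤ) (p : Fin n → ℚ → ℚ) (x : Fin n → ℚ) (i : Fin n) (Q : ℤ)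
    (j : Fin n) : List ((ℤ × ℤ) × ℤ) :=
  ((key j (x j), if j = i then 0 else 1), Q) :: (g.X j).map fun v =>
    ((key j v, 0), (if j = i then -1 else 1) * scale Q ((p j v).num, (p j v).den))

theorem toAlg_shapTerms {p : Fin n → ℚ → ℚ} (x : Fin n → ℚ) (i : Fin n) {Q : ℤ} {j : Fin n}
    (hQ : ∀ v ∈ g.X j, ((p j v).den : ℤ) ∣ Q) :
    toAlg (shapTerms g key p x i Q j) =
      (Q : ℚ) • (AddMonoidAlgebra.single (key j (x j), if j = i then 0 else 1) 1 +
        (if j = i then -1 else 1 : ℚ) • randomKey g key p j) := by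
  rw [shapTerms, toAlg_cons, toAlg_map _ (g.nodup j), smul_add, randomKey, Finset.smul_sum,
    Finset.smul_sum]
  congr 1
  · simp
  · refine Finset.sum_congr rfl fun v hv => ?_
    have hden : (0 : ℤ) < (p j v).den := by exact_mod_cast (p j v).den_pos
    have := scale_cast (q := ((p j v).num, ((p j v).den : ℤ))) hden
      (hQ v (List.mem_toFinset.1 hv))
    simp only [Int.cast_natCast, Rat.num_div_den] at this
    rw [Int.cast_mul, this, AddMonoidAlgebra.smul_single, AddMonoidAlgebra.smul_single]
    congr 1
    split_ifs <;> simp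

/-- Expanding the product over the features `j ≠ i` into a sum over the sets `S` of fixed features
shows the differences that the Shapley value averages. -/
theorem toAlg_prod_shapTerms {p : Fin n → ℚ → ℚ} (x : Fin n → ℚ) (i : Fin n) {Q : ℤ}
    (hQ : ∀ j, ∀ v ∈ g.X j, ((p j v).den : ℤ) ∣ Q) :
    toAlg (prodTerms (κ, 0) (List.ofFn (shapTerms g key p x i Q))) =
      (Q : ℚ) ^ n • ∑ S ∈ (Finset.univ.erase i).powerset,
        (AddMonoidAlgebra.single (κ, (S.card : ℤ)) 1 * ∏ j, partialKey g key p x (insert i S) j -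
          AddMonoidAlgebra.single (κ, (S.card : ℤ)) 1 * ∏ j, partialKey g key p x S j) := by
  rw [toAlg_prodTerms, List.map_ofFn, List.prod_ofFn]
  simp only [Function.comp_apply, toAlg_shapTerms g x i (hQ _)]
  rw [Finset.prod_smul, Finset.prod_const, Finset.card_univ, Fintype.card_fin, mul_smul_comm,
    ← Finset.mul_prod_erase _ _ (Finset.mem_univ i)]
  congr 1
  have h₁ : ∏ j ∈ Finset.univ.erase i,
      ((AddMonoidAlgebra.single (key j (x j), if j = i then 0 else 1) 1 +
        (if j = i then -1 else 1 : ℚ) • randomKey g key p j) : AddMonoidAlgebra ℚ (ℤ × ℤ)) =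
      ∏ j ∈ Finset.univ.erase i, (AddMonoidAlgebra.single (key j (x j), 1) 1 +
        randomKey g key p j) := by
    refine Finset.prod_congr rfl fun j hj => ?_
    simp [Finset.ne_of_mem_erase hj]
  rw [h₁, Finset.prod_add, Finset.mul_sum, Finset.mul_sum]
  refine Finset.sum_congr rfl fun S hS => ?_
  have hiS : i ∉ S := fun h => by simpa using Finset.mem_powerset.1 hS h
  have hsub : S ⊆ Finset.univ.erase i := Finset.mem_powerset.1 hS
  -- Counting the features in `S` one by one or all at once.
  have h₂ : (AddMonoidAlgebra.single (κ, (S.card : ℤ)) 1 : AddMonoidAlgebra ℚ (ℤ × ℤ)) *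
      ∏ j ∈ S, AddMonoidAlgebra.single (key j (x j), 0) 1 =
      AddMonoidAlgebra.single (κ, 0) 1 * ∏ j ∈ S, AddMonoidAlgebra.single (key j (x j), 1) 1 := by
    rw [AddMonoidAlgebra.prod_single, AddMonoidAlgebra.prod_single,
      AddMonoidAlgebra.single_mul_single, AddMonoidAlgebra.single_mul_single, pair_add_sum, pair_add_sum]
    simp
  have h₃ : ∀ U, (∀ j ∈ Finset.univ.erase i, j ∈ U ↔ j ∈ S) →
      ∏ j ∈ Finset.univ.erase i, partialKey g key p x U j =
        (∏ j ∈ S, AddMonoidAlgebra.single (key j (x j), 0) 1) *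
          ∏ j ∈ Finset.univ.erase i \ S, randomKey g key p j := by
    intro U hU
    rw [← Finset.prod_sdiff hsub, mul_comm]
    congr 1
    · refine Finset.prod_congr rfl fun j hj => ?_
      rw [partialKey, if_pos ((hU j (hsub hj)).2 hj)]
    · refine Finset.prod_congr rfl fun j hj => ?_
      rw [Finset.mem_sdiff] at hj
      rw [partialKey, if_neg fun h => hj.2 ((hU j hj.1).1 h)]
  rw [← Finset.mul_prod_erase _ (partialKey g key p x (insert i S)) (Finset.mem_univ i),
    ← Finset.mul_prod_erase _ (partialKey g key p x S) (Finset.mem_univ i),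
    h₃ S fun _ _ => Iff.rfl, h₃ (insert i S) fun j hj => by
      simp [Finset.ne_of_mem_erase hj], partialKey, partialKey, if_pos (Finset.mem_insert_self i S),
    if_neg hiS, if_pos rfl, if_pos rfl, neg_smul, one_smul]
  linear_combination (-(AddMonoidAlgebra.single (key i (x i), 0) 1 - randomKey g key p i) *
    (∏ j ∈ Finset.univ.erase i \ S, randomKey g key p j)) * h₂

/-- The factorial of `k`, computed as a product over the numbers up to `n`, for `0 ≤ k ≤ n`. -/
def factorialUpTo (n : ℕ) (k : ℤ) : ℤ :=
  (((List.range n).map fun j : ℕ => (j : ℤ)).map fun j => if j + 1 ≤ k then j + 1 else 1).prod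

theorem factorialUpTo_eq (n k : ℕ) : factorialUpTo n k = ((min k n).factorial : ℕ) := by
  induction n with
  | zero => simp [factorialUpTo]
  | succ n ih =>
    rw [factorialUpTo] at ih ⊢
    rw [List.range_succ, List.map_append, List.map_append, List.prod_append, ih]
    by_cases h : n + 1 ≤ k
    · have h' : ((n : ℤ) + 1 ≤ k) := by omega
      rw [min_eq_right (by omega), min_eq_right (by omega), Nat.factorial_succ]
      simp only [List.map_cons, List.map_nil, List.prod_singleton, if_pos h']
      push_cast
      ring
    · have h' : ¬ ((n : ℤ) + 1 ≤ k) := by omega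
      rw [min_eq_left (by omega), min_eq_left (by omega)]
      simp only [List.map_cons, List.map_nil, List.prod_singleton, if_neg h', mul_one]

/-- The Shapley weight of a coalition of size `k`, up to the factor `n!`. -/
def shapWeight (n : ℕ) (k : ℤ) : ℤ := factorialUpTo n k * factorialUpTo n (n - 1 - k)

/-- The Shapley value is read off from the product. -/
theorem shap_eq (hD : 0 < D) (hκ : (κ : ℚ) = D * g.β₀)
    (hkey : ∀ i, ∀ v ∈ g.X i, (key i v : ℚ) = D * (g.β i * g.f i v)) {x : Fin n → ℚ}
    (hx : ∀ i, x i ∈ g.X i) {p : Fin n → ℚ → ℚ} (hp : g.IsProductDistribution p) (i : Fin n) {Q : ℤ}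
    (hQ0 : 0 < Q) (hQ : ∀ j, ∀ v ∈ g.X j, ((p j v).den : ℤ) ∣ Q) {A : List ((ℤ × ℤ) × ℤ)}
    (hA : A = prodTerms (κ, 0) (List.ofFn (shapTerms g key p x i Q))) :
    ((((A.filter fun p => 0 ≤ p.1.1).map fun p => p.2 * shapWeight n p.1.2).sum : ℤ) : ℚ) /
      ((factorialUpTo n n * Q ^ n : ℤ) : ℚ) = g.shap p x i := by
  have h₁ := functional_toAlg (fun κ => if 0 ≤ κ.1 then ((shapWeight n κ.2 : ℤ) : ℚ) else 0) A
  rw [sum_mul_indicator A (fun κ => 0 ≤ κ.1) fun κ => shapWeight n κ.2] at h₁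
  have hQ' : (Q : ℚ) ≠ 0 := by exact_mod_cast hQ0.ne'
  have hn : (n.factorial : ℚ) ≠ 0 := by exact_mod_cast n.factorial_ne_zero
  have hV : ∀ (U : Finset (Fin n)) (k : ℤ),
      functional (fun κ => if 0 ≤ κ.1 then ((shapWeight n κ.2 : ℤ) : ℚ) else 0)
        (AddMonoidAlgebra.single (κ, k) 1 * ∏ j, partialKey g key p x U j) =
      shapWeight n k * g.valueFunction p x U := by
    intro U k
    rw [functional_partialKey g hp, valueFunction_eq g hD hκ hkey hx hp, Finset.mul_sum]
    refine Finset.sum_congr rfl fun z hz => ?_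
    rw [classify_eq g hD hκ hkey fun i => ?_]
    · split_ifs
      · ring
      · ring
    · by_cases hi : i ∈ U
      · simpa [hi] using hx i
      · simpa [hi] using List.mem_toFinset.1 (Fintype.mem_piFinset.1 hz i)
  rw [← h₁, hA, toAlg_prod_shapTerms g x i hQ, map_smul, map_sum, factorialUpTo_eq, min_self,
    GAM.shap, smul_eq_mul, Int.cast_mul, Int.cast_pow, Int.cast_natCast, mul_comm,
    mul_div_mul_right _ _ (pow_ne_zero n hQ'), Finset.sum_div]
  refine Finset.sum_congr rfl fun S hS => ?_
  have hcard : S.card + 1 ≤ n := by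
    have := Finset.card_le_card (Finset.mem_powerset.1 hS)
    rw [Finset.card_erase_of_mem (Finset.mem_univ i), Finset.card_univ, Fintype.card_fin] at this
    have := i.pos
    omega
  have hw : shapWeight n S.card = ((S.card.factorial * (n - S.card - 1).factorial : ℕ) : ℤ) := by
    rw [shapWeight, show (n : ℤ) - 1 - S.card = ((n - S.card - 1 : ℕ) : ℤ) by omega,
      factorialUpTo_eq, factorialUpTo_eq, min_eq_left (by omega), min_eq_left (by omega),
      Nat.cast_mul]
  rw [map_sub, hV, hV, hw, Int.cast_natCast]
  ring

end

/-! ### The two queries in pseudo-polynomial time -/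

section

variable {I γ : Type} [Datum γ] {sz : I → ℕ} {e : I → γ}

theorem PolyTime.pseudoPolyTime {encode : I → Val} {mag : I → ℕ} {q : I → ℚ} {out : I → ℤ × ℤ}
    (h : PolyTime (fun a => (encode a).size + mag a) encode out)
    (hout : ∀ a, 0 < (out a).2 ∧ ((out a).1 : ℚ) / ((out a).2 : ℚ) = q a) :
    PseudoPolyTime encode mag q := by
  obtain ⟨f, t, ⟨P, hP⟩, -, h⟩ := h
  exact ⟨f, P, fun a => ⟨_, _, h a, ⟨_, _, (hout a).1, rfl, (hout a).2⟩, hP a⟩⟩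

theorem PolyTime.factorialUpTo {α : Type} [Datum α] {l : I → List α} {n : I → ℕ} {k : I → ℤ}
    (hl : PolyTime sz e l) (hn : ∀ a, (l a).length = n a) (hk : PolyTime sz e k) :
    PolyTime sz e fun a => factorialUpTo (n a) (k a) := by
  obtain rfl : (fun a => (l a).length) = n := funext hn
  exact (hl.range.map (g := fun a j => if j + 1 ≤ k a then j + 1 else 1) fun _ he hj =>
    have hj' := hj.add (hj.const (1 : ℤ))
    (hj'.le (hk.weaken he)).ite hj' (hj.const 1)).prod

/-- The terms with a nonnegative score. -/
theorem PolyTime.nonnegTerms {l : I → List ((ℤ × ℤ) × ℤ)} (hl : PolyTime sz e l) :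
    PolyTime sz e fun a => (l a).filter fun p => 0 ≤ p.1.1 :=
  hl.filter (p := fun _ p => 0 ≤ p.1.1) fun _ _ hp => (hp.const (0 : ℤ)).le hp.fst.fst

theorem keySum_ccTerms_le {C : ComponentKind} {n : ℕ} (g : GAM C n) (key : Fin n → ℚ → ℤ)
    (S : Finset (Fin n)) {x : Fin n → ℚ} (hx : ∀ i, x i ∈ g.X i) (i : Fin n) :
    keySum (ccTerms g key S x i) ≤ ((g.X i).map fun v => (key i v).natAbs).sum := by
  rw [keySum, ccTerms]
  split_ifs
  · simpa using sum_natAbs_key_le g (hx i)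
  · rw [List.map_map]
    rfl

theorem keySum_shapTerms_le {C : ComponentKind} {n : ℕ} (g : GAM C n) (key : Fin n → ℚ → ℤ)
    (p : Fin n → ℚ → ℚ) {x : Fin n → ℚ} (hx : ∀ i, x i ∈ g.X i) (i : Fin n) (Q : ℤ) (j : Fin n) :
    keySum (shapTerms g key p x i Q j) ≤
      2 * ((g.X j).map fun v => (key j v).natAbs).sum := by
  have := sum_natAbs_key_le g (key := key) (hx j)
  rw [keySum, shapTerms, List.map_cons, List.sum_cons, List.map_map]
  simp only [Function.comp_def]
  omega

theorem completionCount_pseudoPolyTime {C : ComponentKind} (hC : C.PolyTimeInference) :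
    PseudoPolyTime (I := CCInstance C) (fun a => a.encode) (fun a => a.g.magnitude)
      (fun a => a.g.completionCount a.x a.S) := by
  let sz : CCInstance C → ℕ := fun a => a.encode.size + a.g.magnitude
  have hmag : PolyBounded sz fun a => a.g.magnitude :=
    PolyBounded.self.mono fun a => Nat.le_add_left _ _
  have hself : PolyTime sz (fun a => a.encode) fun a => a.encode :=
    .refl (PolyBounded.self.mono fun a => Nat.le_add_right _ _)
  have hinst : PolyTime sz (fun a => a.encode) fun a => (a.g.encode, List.ofFn a.x,
      List.ofFn fun i => if i ∈ a.S then (1 : ℤ) else 0) := hself.congr fun a => by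
    change Val.pair _ (Val.pair (Val.ofList _) (Val.ofList _)) =
      Val.pair _ (Val.pair (Val.ofList (List.map _ _)) (Val.ofList (List.map _ _)))
    rw [List.map_ofFn, List.map_ofFn]
    congr 4
    funext i
    by_cases h : i ∈ a.S <;> simp [h] <;> rfl
  obtain ⟨D, κ, key, hD, hκ, hkey, hκt, htable⟩ :=
    exists_keys hC (fun a => a.hx) hinst.fst hinst.snd.fst
  choose u hu hκu hkeyu hle using fun a =>
    exists_unit a.g (hD a) (hκ a) (hkey a)
  have hterms : PolyTime sz (fun a => a.encode) fun a =>
      List.ofFn (ccTerms a.g (key a) a.S a.x) := by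
    refine ((htable.zip hinst.snd.snd fun a => by simp).map (g := fun _ r =>
      if r.2 = 1 then [((r.1.1, (0 : ℤ)), (1 : ℤ))] else r.1.2.map fun k => ((k, 0), 1))
      fun _ _ hr => ?_).congr fun a => ?_
    · exact (hr.snd.eq (hr.const (1 : ℤ))).ite
        (((hr.fst.fst.pair (hr.const (0 : ℤ))).pair (hr.const (1 : ℤ))).cons hr.nil)
        (hr.fst.snd.map fun _ _ hk => (hk.pair (hk.const (0 : ℤ))).pair (hk.const (1 : ℤ)))
    · rw [zip_ofFn, List.map_ofFn]
      congr 2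
      funext i
      by_cases h : i ∈ a.S <;> simp [h, ccTerms]
  have hprod : PolyTime sz (fun a => a.encode) fun a =>
      prodTerms (κ a, 0) (List.ofFn (ccTerms a.g (key a) a.S a.x)) := by
    refine hκt.prodTerms hterms hmag hu hκu (fun a l hl q hq => ?_) fun a => ?_
    · obtain ⟨i, rfl⟩ := (List.mem_ofFn' _ _).1 hl
      rw [ccTerms] at hq
      split_ifs at hq
      · rw [List.mem_singleton.1 hq]
        exact ⟨hkeyu a i _ (a.hx i), by simp⟩
      · obtain ⟨v, hv, rfl⟩ := List.mem_map.1 hq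
        exact ⟨hkeyu a i v hv, by simp⟩
    · refine le_trans (Nat.add_le_add_left ?_ _) (hle a)
      rw [List.map_ofFn, List.sum_ofFn]
      exact Finset.sum_le_sum fun i _ => keySum_ccTerms_le a.g (key a) a.S a.hx i
  have hscore : PolyTime sz (fun a => a.encode) fun a => κ a + ∑ i, key a i (a.x i) :=
    hκt.add ((htable.map (g := fun _ r => r.1) fun _ _ hr => hr.fst).sum.congr fun a => by
      rw [List.map_ofFn, List.sum_ofFn]
      rfl)
  have hP := (hprod.nonnegTerms.map (g := fun _ p => p.2) fun _ _ hp => hp.snd).sum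
  have hT := (hprod.map (g := fun _ p => p.2) fun _ _ hp => hp.snd).sum
  exact ((((hscore.const (0 : ℤ)).le hscore).ite hP (hT.sub hP)).pair hT).pseudoPolyTime
    fun a => completionCount_eq a.g (hD a) (hκ a) (hkey a) a.hx a.S rfl rfl rfl

theorem shap_pseudoPolyTime {C : ComponentKind} (hC : C.PolyTimeInference) :
    PseudoPolyTime (I := ShapInstance C) (fun a => a.encode) (fun a => a.g.magnitude)
      (fun a => a.g.shap a.p a.x a.i) := by
  let sz : ShapInstance C → ℕ := fun a => a.encode.size + a.g.magnitude
  have hmag : PolyBounded sz fun a => 2 * a.g.magnitude :=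
    (PolyBounded.const 2).mul (PolyBounded.self.mono fun a => Nat.le_add_left _ _)
  have hself : PolyTime sz (fun a => a.encode) fun a => a.encode :=
    .refl (PolyBounded.self.mono fun a => Nat.le_add_right _ _)
  have hinst : PolyTime sz (fun a => a.encode) fun a => (a.g.encode,
      (List.ofFn fun j => (a.g.X j).map (a.p j)), List.ofFn a.x, ((a.i : ℕ) : ℤ)) :=
    hself.congr fun a => by
      change Val.pair _ (Val.pair (Val.ofList _) (Val.pair (Val.ofList _) _)) =
        Val.pair _ (Val.pair (Val.ofList (List.map _ _)) (Val.pair (Val.ofList (List.map _ _)) _))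
      rw [List.map_ofFn, List.map_ofFn]
      congr 4
      funext j
      change _ = Val.ofList _
      rw [List.map_map]
      rfl
  obtain ⟨D, κ, key, hD, hκ, hkey, hκt, htable⟩ :=
    exists_keys hC (fun a => a.hx) hinst.fst hinst.snd.snd.fst
  choose u hu hκu hkeyu hle using fun a =>
    exists_unit a.g (hD a) (hκ a) (hkey a)
  -- A common denominator of the probabilities.
  let Q : ShapInstance C → ℤ := fun a => ((List.ofFn fun j => (a.g.X j).map (a.p j)).map
    fun l => (l.map fun q => (q.den : ℤ)).prod).prod
  have hQ : PolyTime sz (fun a => a.encode) Q :=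
    (hinst.snd.fst.map (g := fun _ l => (l.map fun q => (q.den : ℤ)).prod) fun _ _ hl =>
      (hl.map (g := fun _ q => (q.den : ℤ)) fun _ _ hq => hq.den).prod).prod
  have hQ0 : ∀ a, 0 < Q a := by
    refine fun a => List.prod_pos fun d hd => ?_
    obtain ⟨l, -, rfl⟩ := List.mem_map.1 hd
    refine List.prod_pos fun d hd => ?_
    obtain ⟨q, -, rfl⟩ := List.mem_map.1 hd
    exact_mod_cast q.den_pos
  have hQd : ∀ a j, ∀ v ∈ a.g.X j, ((a.p j v).den : ℤ) ∣ Q a := by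
    intro a j v hv
    refine dvd_trans (b := (((a.g.X j).map (a.p j)).map fun q => (q.den : ℤ)).prod)
      (List.dvd_prod ?_) (List.dvd_prod ?_)
    · exact List.mem_map_of_mem (f := fun q : ℚ => (q.den : ℤ)) (List.mem_map_of_mem hv)
    · rw [List.map_ofFn, List.mem_ofFn']
      exact ⟨j, rfl⟩
  have hrows : PolyTime sz (fun a => a.encode) fun a => List.ofFn fun j : Fin a.n =>
      (((key a j (a.x j), (a.g.X j).map (key a j)), (a.g.X j).map (a.p j)), ((j : ℕ) : ℤ)) :=
    ((htable.zip hinst.snd.fst fun a => by simp).zip htable.range fun a => by simp).congr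
      fun a => by
        have : (List.range a.n).map (fun k : ℕ => (k : ℤ)) =
            List.ofFn fun j : Fin a.n => ((j : ℕ) : ℤ) := by
          apply List.ext_getElem <;> simp
        rw [zip_ofFn, List.length_ofFn, this, zip_ofFn]
  have hterms : PolyTime sz (fun a => a.encode) fun a =>
      List.ofFn (shapTerms a.g (key a) a.p a.x a.i (Q a)) := by
    refine (hrows.map (g := fun a r =>
      ((r.1.1.1, if r.2 = ((a.i : ℕ) : ℤ) then (0 : ℤ) else 1), Q a) ::
        (r.1.1.2.zip r.1.2).map fun t => ((t.1, (0 : ℤ)),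
          (if r.2 = ((a.i : ℕ) : ℤ) then (-1 : ℤ) else 1) * scale (Q a) (t.2.num, t.2.den)))
      fun _ he hr => ?_).congr fun a => ?_
    · have hi := hr.snd.eq (hinst.snd.snd.snd.weaken he)
      refine ((hr.fst.fst.fst.pair (hi.ite (hr.const 0) (hr.const 1))).pair (hQ.weaken he)).cons
        ((hr.fst.fst.snd.zip hr.fst.snd fun j => ?_).map fun _ he' ht =>
          (ht.fst.pair (ht.const (0 : ℤ))).pair
            (((hi.ite (hr.const (-1)) (hr.const 1)).weaken he').mul
              (((hQ.weaken he).weaken he').scale (ht.snd.num.pair ht.snd.den))))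
      obtain ⟨i, hi⟩ := (List.mem_ofFn' _ _).1 j.mem
      rw [← hi]
      simp
    · rw [List.map_ofFn]
      congr 2
      funext j
      have hij : (((j : ℕ) : ℤ) = ((a.i : ℕ) : ℤ)) = (j = a.i) := by
        rw [Nat.cast_inj, Fin.val_inj]
      simp only [Function.comp_apply, shapTerms, hij, List.zip_map', List.map_map,
        Function.comp_def]
  have hprod : PolyTime sz (fun a => a.encode) fun a =>
      prodTerms (κ a, 0) (List.ofFn (shapTerms a.g (key a) a.p a.x a.i (Q a))) := by
    refine hκt.prodTerms hterms hmag hu hκu (fun a l hl q hq => ?_) fun a => ?_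
    · obtain ⟨j, rfl⟩ := (List.mem_ofFn' _ _).1 hl
      rw [shapTerms] at hq
      rcases List.mem_cons.1 hq with rfl | hq
      · refine ⟨hkeyu a j _ (a.hx j), ?_⟩
        dsimp only
        split_ifs <;> simp
      · obtain ⟨v, hv, rfl⟩ := List.mem_map.1 hq
        exact ⟨hkeyu a j v hv, by simp⟩
    · have h₁ : ((List.ofFn (shapTerms a.g (key a) a.p a.x a.i (Q a))).map keySum).sum ≤
          2 * ∑ j, ((a.g.X j).map fun v => (key a j v).natAbs).sum := by
        rw [List.map_ofFn, List.sum_ofFn, Finset.mul_sum]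
        exact Finset.sum_le_sum fun j _ => keySum_shapTerms_le a.g (key a) a.p a.hx a.i (Q a) j
      have h₂ := hle a
      rw [Nat.mul_left_comm]
      omega
  have hlen : ∀ a, (List.ofFn fun j => (key a j (a.x j), (a.g.X j).map (key a j))).length = a.n :=
    fun a => by simp
  have hn : PolyTime sz (fun a => a.encode) fun a => (a.n : ℤ) :=
    htable.length.congr fun a => by rw [hlen]
  have hnum := (hprod.nonnegTerms.map (g := fun a p => p.2 * shapWeight a.n p.1.2)
    fun _ he hp => hp.snd.mul (((htable.weaken he).factorialUpTo (fun _ => hlen _) hp.fst.snd).mul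
      ((htable.weaken he).factorialUpTo (fun _ => hlen _)
        (((hn.weaken he).sub (hp.const (1 : ℤ))).sub hp.fst.snd)))).sum
  have hpow : PolyTime sz (fun a => a.encode) fun a => Q a ^ a.n :=
    (htable.map (g := fun a _ => Q a) fun _ he _ => hQ.weaken he).prod.congr fun a => by
      rw [List.map_const', List.prod_replicate, hlen]
  refine (hnum.pair ((htable.factorialUpTo hlen hn).mul hpow)).pseudoPolyTime fun a => ⟨?_, ?_⟩
  · refine mul_pos ?_ (pow_pos (hQ0 a) _)
    rw [factorialUpTo_eq]
    exact_mod_cast Nat.factorial_pos _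
  · exact shap_eq a.g (hD a) (hκ a) (hkey a) a.hx a.hp a.i (hQ0 a) (hQd a) rfl

end
end GamExplain

theorem proposition4 (C : GamExplain.ComponentKind) (hC : C.PolyTimeInference) :
    GamExplain.PseudoPolyTime (I := GamExplain.CCInstance C)
        (fun a => a.encode) (fun a => a.g.magnitude) (fun a => a.g.completionCount a.x a.S) ∧
      GamExplain.PseudoPolyTime (I := GamExplain.ShapInstance C)
        (fun a => a.encode) (fun a => a.g.magnitude) (fun a => a.g.shap a.p a.x a.i) :=
  ⟨GamExplain.completionCount_pseudoPolyTime hC, GamExplain.shap_pseudoPolyTime hC⟩
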